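/- Let $H$ be a complex Hilbert space and $A\subseteq B(H)$ a $C^*$-algebra (a norm-closed $*$-subalgebra, not necessarily unital or separable). Denote by $K(\ell^2)\otimes A\subseteq B(\ell^2(\mathbb N,H))$ the minimal tensor product, i.e. the norm-closed linear span of the elementary tensors $e_{p,q}\otimes a$ ($p,q\in\mathbb N$, $a\in A$, with $e_{p,q}$ the matrix units), and write $T\in K(\ell^2)\otimes A$ as a matrix $(T_{p,q})_{p,q\in\mathbb N}$ with $T_{p,q}\in A$. A family $\varphi:\mathbb N\times\mathbb N\to CB(A)$ of completely bounded maps $A\to A$, bounded in the completely bounded norm, is a Schur $A$-multiplier if $$S_\varphi\big((T_{p,q})_{p,q}\big)=\big(\varphi(q,p)(T_{p,q})\big)_{p,q}$$ defines a completely bounded map $S_\varphi: K(\ell^2)\otimes A\to K(\ell^2)\otimes A$. It is called compact if $S_\varphi$ is a compact operator. It is called completely compact if $S_\varphi$ is completely compact, i.e. for every $\varepsilon>0$ there is a finite-dimensional subspace $F\subseteq K(\ell^2)\otimes A$ such that $\operatorname{dist}\big(S_\varphi^{(m)}(x),M_m(F)\big)<\varepsilon$ for all $m\in\mathbb N$ and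 all $x\in M_m(K(\ell^2)\otimes A)$ with $\|x\|\le 1$, where $S_\varphi^{(m)}$ denotes the entrywise application of $S_\varphi$. Suppose that $A$ is $*$-isomorphic to a $*$-subalgebra of $M_n\otimes C(\Omega)$ for some $n\in\mathbb N$ and some compact Hausdorff space $\Omega$. Then every compact Schur $A$-multiplier is completely compact. -/

import Mathlib

namespace SchurMult

noncomputable section

/-! ### Concrete operator spaces

A concrete operator space is a linear subspace `V` of the bounded operators `E →L[ℂ] E` on a complex
Hilbert space `E`; the norm of `M_m(V)` is the one inherited from the bounded operators on `E^m`. -/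

section OperatorSpaces

variable {E : Type*} [NormedAddCommGroup E] [InnerProductSpace ℂ E]
variable {G : Type*} [NormedAddCommGroup G] [InnerProductSpace ℂ G]

/-- The operator `ξ ↦ (∑ j, x i j (ξ j))_i` on the Hilbert space `E^m` given by an `m × m` matrix
of bounded operators on `E`. -/
def matOp {m : ℕ} (x : Matrix (Fin m) (Fin m) (E →L[ℂ] E)) :
    PiLp 2 (fun _ : Fin m => E) →L[ℂ] PiLp 2 (fun _ : Fin m => E) :=
  ((PiLp.continuousLinearEquiv 2 ℂ (fun _ : Fin m => E)).symm :
      (Fin m → E) →L[ℂ] PiLp 2 (fun _ : Fin m => E)) ∘L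
    ContinuousLinearMap.pi fun i => ∑ j, x i j ∘L PiLp.proj 2 (fun _ : Fin m => E) j

/-- The norm of `M_m(B(E))`, that is, the operator norm on `E^m`. -/
def matNorm {m : ℕ} (x : Matrix (Fin m) (Fin m) (E →L[ℂ] E)) : ℝ := ‖matOp x‖

/-- A matrix over the subspace `V` of `B(E)`, seen as a matrix over `B(E)`. -/
def matCoe {V : Submodule ℂ (E →L[ℂ] E)} {m : ℕ} (x : Matrix (Fin m) (Fin m) V) :
    Matrix (Fin m) (Fin m) (E →L[ℂ] E) :=
  x.map fun v => (v : E →L[ℂ] E)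

/-- The completely bounded norm of `Φ` is at most `C`: all the amplifications
`Φ^(m) : M_m(V) → M_m(W)` have norm at most `C`. -/
def CBNormLE {V : Submodule ℂ (E →L[ℂ] E)} {W : Submodule ℂ (G →L[ℂ] G)}
    (Φ : V →ₗ[ℂ] W) (C : ℝ) : Prop :=
  ∀ (m : ℕ) (x : Matrix (Fin m) (Fin m) V),
    matNorm (matCoe (x.map Φ)) ≤ C * matNorm (matCoe x)

/-- Completely bounded linear maps. -/
def IsCompletelyBounded {V : Submodule ℂ (E →L[ℂ] E)} {W : Submodule ℂ (G →L[ℂ] G)}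
    (Φ : V →ₗ[ℂ] W) : Prop :=
  ∃ C : ℝ, CBNormLE Φ C

/-- Completely compact maps: completely bounded maps such that for each `ε > 0` there is a finite
dimensional subspace `F` of the target with `dist (Φ^(m) x, M_m(F)) < ε` for all `m` and all `x` in
the closed unit ball of `M_m(V)`. -/
def IsCompletelyCompact {V : Submodule ℂ (E →L[ℂ] E)} {W : Submodule ℂ (G →L[ℂ] G)}
    (Φ : V →ₗ[ℂ] W) : Prop :=
  IsCompletelyBounded Φ ∧
    ∀ ε : ℝ, 0 < ε → ∃ F : Submodule ℂ W, FiniteDimensional ℂ F ∧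
      ∀ (m : ℕ) (x : Matrix (Fin m) (Fin m) V), matNorm (matCoe x) ≤ 1 →
        ∃ y : Matrix (Fin m) (Fin m) W, (∀ i j, y i j ∈ F) ∧
          matNorm (matCoe (x.map Φ - y)) < ε

end OperatorSpaces

/-! ### Schur multipliers on `ℕ × ℕ` -/

section Schur

variable {H : Type*} [NormedAddCommGroup H] [InnerProductSpace ℂ H]

/-- The Hilbert space `ℓ²(ℕ, H) = H^∞`. -/
abbrev Ell2 (H : Type*) [NormedAddCommGroup H] [InnerProductSpace ℂ H] : Type _ :=
  lp (fun _ : ℕ => H) 2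

/-- The `(m, n)` entry of a bounded operator on `ℓ²(ℕ, H)`, a bounded operator on `H`. -/
def entry (m n : ℕ) : (Ell2 H →L[ℂ] Ell2 H) →ₗ[ℂ] (H →L[ℂ] H) where
  toFun T := lp.evalCLM ℂ (fun _ : ℕ => H) 2 m ∘L T ∘L
    lp.singleContinuousLinearMap ℂ (fun _ : ℕ => H) 2 n
  map_add' S T := by ext; simp
  map_smul' c T := by ext; simp

/-- `e_{m,n} ⊗ a`: the operator on `ℓ²(ℕ, H)` whose only nonzero entry is `a`, at `(m, n)`. -/
def matUnit (m n : ℕ) (a : H →L[ℂ] H) : Ell2 H →L[ℂ] Ell2 H :=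
  lp.singleContinuousLinearMap ℂ (fun _ : ℕ => H) 2 m ∘L a ∘L
    lp.evalCLM ℂ (fun _ : ℕ => H) 2 n

/-- The minimal (spatial) tensor product `K(ℓ²) ⊗ V` inside the bounded operators on
`ℓ²(ℕ, H) = ℓ² ⊗ H`: the norm closure of the linear span of the elementary tensors
`e_{m,n} ⊗ a`, `a ∈ V` (the linear span of the `e_{m,n}` being norm dense in `K(ℓ²)`). -/
def compactTensor (V : Submodule ℂ (H →L[ℂ] H)) : Submodule ℂ (Ell2 H →L[ℂ] Ell2 H) :=
  (Submodule.span ℂ {T | ∃ (m n : ℕ) (a : H →L[ℂ] H), a ∈ V ∧ T = matUnit m n a}).topologicalClosure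

theorem continuous_entry (m n : ℕ) :
    Continuous (entry m n : (Ell2 H →L[ℂ] Ell2 H) → (H →L[ℂ] H)) := by
  change Continuous fun T : Ell2 H →L[ℂ] Ell2 H => lp.evalCLM ℂ (fun _ : ℕ => H) 2 m ∘L T ∘L
    lp.singleContinuousLinearMap ℂ (fun _ : ℕ => H) 2 n
  fun_prop

theorem entry_matUnit (m n p q : ℕ) (a : H →L[ℂ] H) :
    entry m n (matUnit p q a) = if m = p ∧ n = q then a else 0 := by
  ext v
  by_cases h1 : m = p
  · by_cases h2 : n = q
    · simp [entry, matUnit, lp.single_apply, lp.evalCLM, h1, h2]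
    · simp [entry, matUnit, lp.single_apply, lp.evalCLM, h1, h2, Ne.symm h2]
  · simp [entry, matUnit, lp.single_apply, lp.evalCLM, h1]

theorem entry_mem {V : Submodule ℂ (H →L[ℂ] H)} (hV : IsClosed (V : Set (H →L[ℂ] H)))
    {T : Ell2 H →L[ℂ] Ell2 H} (hT : T ∈ compactTensor V) (m n : ℕ) : entry m n T ∈ V := by
  have hcl : IsClosed ((V.comap (entry m n) : Submodule ℂ (Ell2 H →L[ℂ] Ell2 H)) :
      Set (Ell2 H →L[ℂ] Ell2 H)) := hV.preimage (continuous_entry m n)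
  refine Submodule.topologicalClosure_minimal _ (Submodule.span_le.2 ?_) hcl hT
  rintro _ ⟨p, q, a, ha, rfl⟩
  change entry m n (matUnit p q a) ∈ V
  rw [entry_matUnit]
  split_ifs
  · exact ha
  · exact V.zero_mem

/-- `S : K(ℓ²) ⊗ V → K(ℓ²) ⊗ V` is the Schur multiplication
`(T_{m,n})_{m,n} ↦ (φ(n,m)(T_{m,n}))_{m,n}`. -/
def IsSchurMap {V : Submodule ℂ (H →L[ℂ] H)} (hV : IsClosed (V : Set (H →L[ℂ] H)))
    (φ : ℕ × ℕ → (V →ₗ[ℂ] V)) (S : compactTensor V →ₗ[ℂ] compactTensor V) : Prop :=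
  ∀ (T : compactTensor V) (m n : ℕ),
    entry m n (S T : Ell2 H →L[ℂ] Ell2 H) = φ (n, m) ⟨entry m n (T : Ell2 H →L[ℂ] Ell2 H),
      entry_mem hV T.2 m n⟩

/-- `φ : ℕ × ℕ → CB(V)` is a Schur `V`-multiplier and `S` is the associated map `S_φ` on
`K(ℓ²) ⊗ V`: `φ` is a bounded family of completely bounded maps, and the Schur multiplication `S`
by `φ` is a completely bounded map on `K(ℓ²) ⊗ V`. The map `S` is determined by its entries. -/
def IsSchurMultiplier {V : Submodule ℂ (H →L[ℂ] H)} (hV : IsClosed (V : Set (H →L[ℂ] H)))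
    (φ : ℕ × ℕ → (V →ₗ[ℂ] V)) (S : compactTensor V →ₗ[ℂ] compactTensor V) : Prop :=
  (∃ C : ℝ, ∀ p, CBNormLE (φ p) C) ∧ IsSchurMap hV φ S ∧ IsCompletelyBounded S

/-- `φ` is a compact Schur multiplier: `S_φ` is a compact operator on `K(ℓ²) ⊗ V`. -/
def IsCompactSchurMultiplier {V : Submodule ℂ (H →L[ℂ] H)}
    (hV : IsClosed (V : Set (H →L[ℂ] H))) (φ : ℕ × ℕ → (V →ₗ[ℂ] V)) : Prop :=
  ∃ S : compactTensor V →ₗ[ℂ] compactTensor V, IsSchurMultiplier hV φ S ∧ IsCompactOperator S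

/-- `φ` is a completely compact Schur multiplier: `S_φ` is completely compact on `K(ℓ²) ⊗ V`. -/
def IsCompletelyCompactSchurMultiplier {V : Submodule ℂ (H →L[ℂ] H)}
    (hV : IsClosed (V : Set (H →L[ℂ] H))) (φ : ℕ × ℕ → (V →ₗ[ℂ] V)) : Prop :=
  ∃ S : compactTensor V →ₗ[ℂ] compactTensor V, IsSchurMultiplier hV φ S ∧ IsCompletelyCompact S

end Schur

end

end SchurMult

/-! Two properties of a subhomogeneous `A` carry the proof.

(a) Smith's lemma for Schur maps (`norm_blockOp_schurMap_le`): if a Schur map has norm at most δ,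
all its amplifications have norm at most n²δ. The norm of a matrix over `A` is the supremum over the
evaluations ρ_ω : A → M_n, and in each of them only n² coefficients occur. A coefficient of an
amplified matrix is also a coefficient of an unamplified one, obtained by compressing the
amplification index with scalars, and this compression commutes with entrywise maps.

(b) The approximation property (`exists_finiteRank_approx`): on each compact K ⊆ A the identity is
uniformly close to a bounded finite-rank map θ; no bound on ‖θ‖ is needed.

The image of the unit ball under S = S_φ lies in a compact set, so by (b) a finite-rank map C (cut
to an N × N corner, then apply θ to each entry) moves it by at most 2δ. As the same θ acts on every
entry in the corner, S − C∘S is again a Schur map. Its norm is at most 2δ, (a) makes its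
amplifications uniformly small, and the range of C is the required subspace F.

Property (b) is proved by induction on n. At points where ρ_ω is not onto M_n, compressions to
proper reducing subspaces form a compact family of smaller representations, which the induction
hypothesis handles. What remains lives on a compact set of irreducible points, where local
interpolations are glued by a partition of unity in the variable ω ↦ tr ρ_ω. `A` need not contain
scalar functions, but a Capelli identity shows that traces act on the span of the Capelli
expressions, and Stone–Weierstrass extends this approximately to continuous functions of the traces.
Smallness is visible to traces because ‖ρ_ω(z)‖² ≤ tr ρ_ω(z*z). -/

namespace SchurMult

/-! ### Finite-dimensional representations: irreducibility and reducing subspaces. -/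

open scoped Matrix.Norms.L2Operator

-- Burnside's theorem without a unit. Adjoining the identity to the image gives an algebra acting
-- simply, hence all of M_n; the image itself is a two-sided ideal of it, so it is zero or
-- everything.
open Matrix in
theorem surjective_or_eq_zero_or_exists_invariant {A : Type*} [NonUnitalRing A] [StarRing A]
    [Module ℂ A] {n : ℕ} (π : A →⋆ₙₐ[ℂ] Matrix (Fin n) (Fin n) ℂ) :
    Function.Surjective π ∨ (∀ a, π a = 0) ∨ ∃ W : Submodule ℂ (EuclideanSpace ℂ (Fin n)),
      W ≠ ⊥ ∧ W ≠ ⊤ ∧ ∀ a, ∀ w ∈ W, toEuclideanCLM (𝕜 := ℂ) (π a) w ∈ W := by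
  by_contra! hcon
  obtain ⟨hsurj, ⟨a₀, ha₀⟩, hW⟩ := hcon
  refine hsurj ?_
  let T : A → Module.End ℂ (EuclideanSpace ℂ (Fin n)) := fun a =>
    (toEuclideanCLM (𝕜 := ℂ) (π a) : _ →ₗ[ℂ] _)
  let R : Subalgebra ℂ (Module.End ℂ (EuclideanSpace ℂ (Fin n))) := Algebra.adjoin ℂ (Set.range T)
  have hTR : ∀ a, T a ∈ R := fun a => Algebra.subset_adjoin ⟨a, rfl⟩
  have hnt : Nontrivial (EuclideanSpace ℂ (Fin n)) := by
    by_contra h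
    rw [not_nontrivial_iff_subsingleton] at h
    apply ha₀
    apply (toEuclideanCLM (n := Fin n) (𝕜 := ℂ)).injective
    ext1 x
    exact Subsingleton.elim _ _
  have hsimple : IsSimpleModule R (EuclideanSpace ℂ (Fin n)) := by
    refine (isSimpleModule_iff _ _).2 ⟨fun W => ?_⟩
    by_contra! hne
    have hW' : (W.restrictScalars ℂ) ≠ ⊥ := by simpa using hne.1
    have hW'' : (W.restrictScalars ℂ) ≠ ⊤ := by simpa using hne.2
    obtain ⟨a, w, hw, haw⟩ := hW _ hW' hW''
    exact haw (W.smul_mem (⟨T a, hTR a⟩ : R) hw)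
  -- By Schur's lemma the commutant of `R` is scalar, so every `f` commutes with it; Jacobson
  -- density then matches `f` with an element of `R` on a basis.
  have hRtop : ∀ f : Module.End ℂ (EuclideanSpace ℂ (Fin n)), f ∈ R := by
    intro f
    let F : Module.End (Module.End R (EuclideanSpace ℂ (Fin n))) (EuclideanSpace ℂ (Fin n)) :=
      { toFun := f
        map_add' := map_add f
        map_smul' := by
          intro c x
          obtain ⟨z, rfl⟩ := (IsSimpleModule.algebraMap_end_bijective_of_isAlgClosed
            (A := R) (V := EuclideanSpace ℂ (Fin n)) ℂ).2 c
          simp }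
    let b := Module.finBasis ℂ (EuclideanSpace ℂ (Fin n))
    obtain ⟨r, hr⟩ := jacobson_density F (Finset.univ.image b)
    have : f = (r : Module.End ℂ (EuclideanSpace ℂ (Fin n))) := by
      refine b.ext fun i => ?_
      exact hr (b i) (by simp)
    rw [this]
    exact r.2
  -- The image of `A` is a two-sided ideal of the unital algebra `R`.
  have key : ∀ r ∈ R, ∀ a, (∃ c, T c = r * T a) ∧ (∃ c, T c = T a * r) := by
    intro r hr
    have hmul : ∀ x y, T (x * y) = T x * T y := by
      intro x y
      simp only [T, map_mul]
      rfl
    have hadd : ∀ x y, T (x + y) = T x + T y := by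
      intro x y
      simp only [T, map_add]
      rfl
    have hsm : ∀ (k : ℂ) x, T (k • x) = k • T x := by
      intro x y
      simp only [T, map_smul]
      rfl
    refine Algebra.adjoin_induction (p := fun r _ => ∀ a, (∃ c, T c = r * T a) ∧
      (∃ c, T c = T a * r)) ?_ ?_ ?_ ?_ hr
    · rintro _ ⟨x, rfl⟩ a
      exact ⟨⟨_, hmul _ _⟩, ⟨_, hmul _ _⟩⟩
    · intro k a
      refine ⟨⟨k • a, ?_⟩, ⟨k • a, ?_⟩⟩
      · rw [hsm, Algebra.smul_def]
      · rw [hsm, Algebra.smul_def, Algebra.commutes]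
    · intro x y _ _ hx hy a
      obtain ⟨⟨c, hc⟩, ⟨d, hd⟩⟩ := hx a
      obtain ⟨⟨c', hc'⟩, ⟨d', hd'⟩⟩ := hy a
      refine ⟨⟨c + c', ?_⟩, ⟨d + d', ?_⟩⟩
      · rw [hadd, hc, hc', add_mul]
      · rw [hadd, hd, hd', mul_add]
    · intro x y _ _ hx hy a
      obtain ⟨⟨c, hc⟩, -⟩ := hy a
      obtain ⟨⟨c', hc'⟩, -⟩ := hx c
      obtain ⟨-, ⟨d, hd⟩⟩ := hx a
      obtain ⟨-, ⟨d', hd'⟩⟩ := hy d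
      refine ⟨⟨c', ?_⟩, ⟨d', ?_⟩⟩
      · rw [hc', hc, mul_assoc]
      · rw [hd', hd, mul_assoc]
  have key2 : ∀ (X : Matrix (Fin n) (Fin n) ℂ) a, (∃ c, π c = X * π a) ∧ (∃ c, π c = π a * X) := by
    intro X a
    obtain ⟨⟨c, hc⟩, ⟨d, hd⟩⟩ := key _ (hRtop (toEuclideanCLM (𝕜 := ℂ) X : _ →ₗ[ℂ] _)) a
    refine ⟨⟨c, ?_⟩, ⟨d, ?_⟩⟩
    · apply (toEuclideanCLM (n := Fin n) (𝕜 := ℂ)).injective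
      rw [map_mul]
      ext1 x
      exact congrArg (fun f => f x) hc
    · apply (toEuclideanCLM (n := Fin n) (𝕜 := ℂ)).injective
      rw [map_mul]
      ext1 x
      exact congrArg (fun f => f x) hd
  obtain ⟨k, l, hkl⟩ : ∃ k l, π a₀ k l ≠ 0 := by
    by_contra! h
    exact ha₀ (Matrix.ext h)
  have hsing : ∀ i j z, ∃ c, π c = Matrix.single i j z := by
    intro i j z
    obtain ⟨c, hc⟩ := (key2 (Matrix.single i k 1) a₀).1
    obtain ⟨d, hd⟩ := (key2 (Matrix.single l j (z / π a₀ k l)) c).2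
    refine ⟨d, ?_⟩
    rw [hd, hc, Matrix.single_mul_mul_single]
    field_simp
  intro X
  induction X using Matrix.induction_on' with
  | h_zero => exact ⟨0, map_zero _⟩
  | h_add p q hp hq =>
    obtain ⟨c, rfl⟩ := hp
    obtain ⟨d, rfl⟩ := hq
    exact ⟨c + d, map_add _ _ _⟩
  | h_std_basis i j x => exact hsing i j x

open Matrix in
/-- The projection onto a subspace of dimension at most `k` factors through `ℂ^k`. -/
theorem exists_partialIsometry {m k : ℕ} (W : Submodule ℂ (EuclideanSpace ℂ (Fin m)))
    (hW : Module.finrank ℂ W ≤ k) : ∃ V : Matrix (Fin m) (Fin k) ℂ, V * Vᴴ * V = V ∧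
      (∀ w ∈ W, toEuclideanCLM (𝕜 := ℂ) (V * Vᴴ) w = w) ∧
      ∀ w ∈ Wᗮ, toEuclideanCLM (𝕜 := ℂ) (V * Vᴴ) w = 0 := by
  classical
  set d := Module.finrank ℂ W with hd
  let u := stdOrthonormalBasis ℂ W
  let u' : Fin k → EuclideanSpace ℂ (Fin m) := fun j =>
    if h : (j : ℕ) < d then (u ⟨j, h⟩ : EuclideanSpace ℂ (Fin m)) else 0
  let V : Matrix (Fin m) (Fin k) ℂ := Matrix.of fun i j => u' j i
  have hP : ∀ v, toEuclideanCLM (𝕜 := ℂ) (V * Vᴴ) v = ∑ j, inner ℂ (u' j) v • u' j := by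
    intro v
    ext i
    simp only [ofLp_toEuclideanCLM, mulVec, dotProduct, mul_apply, conjTranspose_apply, V,
      PiLp.inner_apply, WithLp.ofLp_sum, WithLp.ofLp_smul, Finset.sum_apply, Pi.smul_apply,
      smul_eq_mul, RCLike.inner_apply, Finset.sum_mul, of_apply]
    rw [Finset.sum_comm]
    refine Finset.sum_congr rfl fun x _ => Finset.sum_congr rfl fun y _ => ?_
    simp only [RCLike.star_def]
    ring
  have hVV : Vᴴ * V = Matrix.diagonal fun j : Fin k => if (j : ℕ) < d then (1 : ℂ) else 0 := by
    ext j l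
    have h1 : (Vᴴ * V) j l = inner ℂ (u' j) (u' l) := by
      simp only [mul_apply, conjTranspose_apply, V, of_apply, PiLp.inner_apply,
        RCLike.inner_apply, RCLike.star_def]
      exact Finset.sum_congr rfl fun _ _ => mul_comm _ _
    rw [h1, diagonal_apply]
    by_cases hj : (j : ℕ) < d
    · by_cases hl : (l : ℕ) < d
      · have := orthonormal_iff_ite.1 u.orthonormal ⟨j, hj⟩ ⟨l, hl⟩
        simp only [Submodule.coe_inner] at this
        simp only [u', hj, hl, dif_pos, this, if_pos, Fin.ext_iff]
      · have : j ≠ l := by rintro rfl; exact hl hj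
        simp [u', hl, this]
    · simp [u', hj]
  have hsum : ∀ v, ∑ j, inner ℂ (u' j) v • u' j =
      ∑ j : Fin d, inner ℂ (u j : EuclideanSpace ℂ (Fin m)) v •
        (u j : EuclideanSpace ℂ (Fin m)) := by
    intro v
    symm
    refine Finset.sum_of_injOn (Fin.castLE hW) (Fin.castLE_injective hW).injOn (by simp) ?_ ?_
    · intro j _ hj
      have : ¬ (j : ℕ) < d := fun h => hj ⟨⟨j, h⟩, by simp, rfl⟩
      simp [u', this]
    · intro j _
      simp [u']
  refine ⟨V, ?_, ?_, ?_⟩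
  · rw [Matrix.mul_assoc, hVV]
    ext i j
    simp only [mul_diagonal, V, of_apply, u']
    split_ifs <;> simp
  · intro w hw
    rw [hP, hsum]
    have := congrArg (fun z : W => (z : EuclideanSpace ℂ (Fin m))) (u.sum_repr' ⟨w, hw⟩)
    simpa using this
  · intro w hw
    rw [hP, hsum]
    refine Finset.sum_eq_zero fun j _ => ?_
    rw [Submodule.inner_right_of_mem_orthogonal (u j).2 hw, zero_smul]

-- V*V is a self-adjoint idempotent, so ‖V‖⁴ = ‖V‖².
open Matrix in
theorem norm_le_one_of_partialIsometry {m k : ℕ} {V : Matrix (Fin m) (Fin k) ℂ}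
    (hV : V * Vᴴ * V = V) : ‖V‖ ≤ 1 := by
  have h1 : ‖(Vᴴ * V)ᴴ * (Vᴴ * V)‖ = ‖Vᴴ * V‖ := by
    congr 1
    rw [conjTranspose_mul, conjTranspose_conjTranspose, Matrix.mul_assoc, ← Matrix.mul_assoc V, hV]
  rw [l2_opNorm_conjTranspose_mul_self, l2_opNorm_conjTranspose_mul_self] at h1
  by_contra! h
  have h2 : 1 < ‖V‖ * ‖V‖ := by nlinarith
  nlinarith

open Matrix in
/-- If every compression of `π a` to a proper reducing subspace is small, then `π a` is small. -/
theorem norm_le_of_compressions {A : Type*} [NonUnitalRing A] [StarRing A] [Module ℂ A] {k : ℕ}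
    (π : A →⋆ₙₐ[ℂ] Matrix (Fin (k + 1)) (Fin (k + 1)) ℂ) (hπ : ¬ Function.Surjective π)
    {ε : ℝ} (hε : 0 ≤ ε) (a : A)
    (ha : ∀ V : Matrix (Fin (k + 1)) (Fin k) ℂ, V * Vᴴ * V = V →
      (∀ b, V * Vᴴ * π b = π b * (V * Vᴴ)) → ‖Vᴴ * π a * V‖ ≤ ε) : ‖π a‖ ≤ 2 * ε := by
  rcases surjective_or_eq_zero_or_exists_invariant π with h | h | ⟨W, hW0, hW1, hW⟩
  · exact absurd h hπ
  · rw [h, norm_zero]; linarith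
  have hWo : ∀ a, ∀ w ∈ Wᗮ, toEuclideanCLM (𝕜 := ℂ) (π a) w ∈ Wᗮ := by
    intro a w hw
    rw [Submodule.mem_orthogonal]
    intro v hv
    have h1 := hW (star a) v hv
    rw [map_star, map_star, ContinuousLinearMap.star_eq_adjoint] at h1
    rw [← ContinuousLinearMap.adjoint_inner_left]
    exact Submodule.inner_right_of_mem_orthogonal h1 hw
  have hdim : Module.finrank ℂ W + Module.finrank ℂ Wᗮ = k + 1 := by
    rw [Submodule.finrank_add_finrank_orthogonal]; simp
  have hWpos : 0 < Module.finrank ℂ W := by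
    rw [Module.finrank_pos_iff_of_free ℂ W]
    exact Submodule.nontrivial_iff_ne_bot.2 hW0
  have hWlt : Module.finrank ℂ W < k + 1 := by
    have := Submodule.finrank_lt hW1
    simpa using this
  have hWoo : Wᗮᗮ = W := Submodule.orthogonal_orthogonal W
  obtain ⟨V, hV, hVW, hVW'⟩ := exists_partialIsometry (k := k) W (by omega)
  obtain ⟨U, hU, hUW, hUW'⟩ := exists_partialIsometry (k := k) Wᗮ (by omega)
  rw [hWoo] at hUW'
  have hadd : ∀ (X : Matrix (Fin (k + 1)) (Fin (k + 1)) ℂ) x y, toEuclideanCLM (𝕜 := ℂ) X (x + y) =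
      toEuclideanCLM (𝕜 := ℂ) X x + toEuclideanCLM (𝕜 := ℂ) X y :=
    fun X x y => ContinuousLinearMap.map_add _ x y
  have hmul : ∀ (X Y : Matrix (Fin (k + 1)) (Fin (k + 1)) ℂ) x, toEuclideanCLM (𝕜 := ℂ) (X * Y) x =
      toEuclideanCLM (𝕜 := ℂ) X (toEuclideanCLM (𝕜 := ℂ) Y x) := by
    intro X Y x
    rw [map_mul]
    rfl
  have hext : ∀ X Y : Matrix (Fin (k + 1)) (Fin (k + 1)) ℂ,
      (∀ x, toEuclideanCLM (𝕜 := ℂ) X x = toEuclideanCLM (𝕜 := ℂ) Y x) → X = Y :=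
    fun X Y h => (toEuclideanCLM (n := Fin (k + 1)) (𝕜 := ℂ)).injective
      (ContinuousLinearMap.ext h)
  have hsum : V * Vᴴ + U * Uᴴ = 1 := by
    refine hext _ _ fun x => ?_
    obtain ⟨y, hy, z, hz, rfl⟩ := Submodule.exists_add_mem_mem_orthogonal (K := W) x
    rw [map_add toEuclideanCLM (V * Vᴴ), map_one, _root_.add_apply, hadd, hadd, hVW y hy,
      hVW' z hz, hUW z hz, hUW' y hy]
    simp
  have comm : ∀ (W : Submodule ℂ (EuclideanSpace ℂ (Fin (k + 1))))
      (V : Matrix (Fin (k + 1)) (Fin k) ℂ)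
      (_ : ∀ a, ∀ w ∈ W, toEuclideanCLM (𝕜 := ℂ) (π a) w ∈ W)
      (_ : ∀ w ∈ W, toEuclideanCLM (𝕜 := ℂ) (V * Vᴴ) w = w)
      (_ : ∀ w ∈ Wᗮ, toEuclideanCLM (𝕜 := ℂ) (V * Vᴴ) w = 0) (b : A),
      V * Vᴴ * π b = π b * (V * Vᴴ) := by
    intro W V hW hV hV' b
    -- Invariance gives PπP = πP for the projection P = VV*; the adjoint of this identity at `star
    -- b` gives PπP = Pπ.
    have h1 : ∀ b, V * Vᴴ * π b * (V * Vᴴ) = π b * (V * Vᴴ) := by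
      intro b
      refine hext _ _ fun x => ?_
      obtain ⟨y, hy, z, hz, rfl⟩ := Submodule.exists_add_mem_mem_orthogonal (K := W) x
      rw [hadd, hadd, hmul (V * Vᴴ * π b), hmul (V * Vᴴ * π b), hmul (π b), hmul (π b), hV y hy,
        hV' z hz, hmul, hV _ (hW b y hy)]
      simp only [ContinuousLinearMap.map_zero]
    have h2 := congrArg conjTranspose (h1 (star b))
    simp only [conjTranspose_mul, conjTranspose_conjTranspose, map_star, star_eq_conjTranspose]
      at h2
    rw [← h1 b]
    simpa only [Matrix.mul_assoc] using h2.symm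
  have hbd : ∀ V : Matrix (Fin (k + 1)) (Fin k) ℂ, V * Vᴴ * V = V →
      (∀ b, V * Vᴴ * π b = π b * (V * Vᴴ)) → ‖π a * (V * Vᴴ)‖ ≤ ε := by
    intro V hV hc
    have h1 : π a * (V * Vᴴ) = V * (Vᴴ * π a * V) * Vᴴ := by
      calc π a * (V * Vᴴ) = π a * (V * Vᴴ * V * Vᴴ) := by rw [hV]
        _ = (π a * (V * Vᴴ)) * (V * Vᴴ) := by simp only [Matrix.mul_assoc]
        _ = _ := by rw [← hc]; simp only [Matrix.mul_assoc]
    have hV1 := norm_le_one_of_partialIsometry hV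
    have hV2 : ‖Vᴴ‖ ≤ 1 := by rwa [l2_opNorm_conjTranspose]
    rw [h1]
    calc _ ≤ ‖V * (Vᴴ * π a * V)‖ * ‖Vᴴ‖ := l2_opNorm_mul _ _
      _ ≤ (‖V‖ * ‖Vᴴ * π a * V‖) * ‖Vᴴ‖ := by gcongr; exact l2_opNorm_mul _ _
      _ ≤ (1 * ε) * 1 := by gcongr; exact ha V hV hc
      _ = ε := by ring
  calc ‖π a‖ = ‖π a * (V * Vᴴ) + π a * (U * Uᴴ)‖ := by rw [← mul_add, hsum, mul_one]
    _ ≤ ‖π a * (V * Vᴴ)‖ + ‖π a * (U * Uᴴ)‖ := norm_add_le _ _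
    _ ≤ ε + ε := add_le_add (hbd V hV (comm W V hW hVW hVW'))
        (hbd U hU (comm Wᗮ U hWo hUW (by rwa [hWoo])))
    _ = 2 * ε := by ring

end SchurMult

/-! ### Capelli expressions and the action of traces on them. -/

namespace SchurMult

-- An alternating map in dim R variables is a multiple of the determinant, and the trace is the
-- derivative of the determinant. Concretely, Cramer's rule turns the sum into tr(T X adj X) = det X
-- · tr T.
open Matrix in
theorem sum_map_update_eq_trace_smul {ι R M : Type*} [Fintype ι] [DecidableEq ι]
    [AddCommGroup R] [Module ℂ R] [AddCommGroup M] [Module ℂ M] (b : Module.Basis ι ℂ R)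
    (f : R [⋀^ι]→ₗ[ℂ] M) (T : R →ₗ[ℂ] R) (x : ι → R) :
    ∑ i, f (Function.update x i (T (x i))) = LinearMap.trace ℂ R T • f x := by
  have hf : f = (LinearMap.toSpanSingleton ℂ M (f b)).compAlternatingMap b.det := by
    refine Module.Basis.ext_alternating b fun v hv => ?_
    have hb : Function.Bijective v := hv.bijective_of_finite
    let σ := Equiv.ofBijective v hb
    have h1 : (fun i => b (v i)) = b ∘ σ := rfl
    rw [h1, AlternatingMap.map_perm]
    simp [AlternatingMap.map_perm, b.det_self]
  have hf' : ∀ y, f y = b.det y • f b := fun y => by conv_lhs => rw [hf]; simp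
  simp_rw [hf' (Function.update _ _ _)]
  rw [hf' x, ← Finset.sum_smul, smul_smul]
  congr 1
  set X : Matrix ι ι ℂ := b.toMatrix x with hX
  have h1 : ∀ i, b.det (Function.update x i (T (x i))) =
      ∑ j, (LinearMap.toMatrix b b T * X) j i * X.adjugate i j := by
    intro i
    rw [Module.Basis.det_apply, Module.Basis.toMatrix_update, ← cramer_apply,
      cramer_eq_adjugate_mulVec, mulVec, dotProduct]
    refine Finset.sum_congr rfl fun j _ => ?_
    rw [mul_comm]
    congr 1
    rw [← LinearMap.toMatrix_mulVec_repr b b T (x i)]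
    rfl
  rw [Finset.sum_congr rfl fun i _ => h1 i, Finset.sum_comm]
  have h2 : ∑ j, ∑ i, (LinearMap.toMatrix b b T * X) j i * X.adjugate i j =
      trace (LinearMap.toMatrix b b T * X * X.adjugate) := by
    simp only [trace, diag_apply, mul_apply (M := _ * X) (N := X.adjugate)]
  rw [h2, Matrix.mul_assoc, Matrix.mul_adjugate, Matrix.mul_smul, mul_one, trace_smul,
    LinearMap.trace_eq_matrix_trace ℂ b, Module.Basis.det_apply, smul_eq_mul, mul_comm]

open Matrix in
theorem trace_mulLeft {n : Type*} [Fintype n] [DecidableEq n] (a : Matrix n n ℂ) :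
    LinearMap.trace ℂ (Matrix n n ℂ) (LinearMap.mulLeft ℂ a) = Fintype.card n * a.trace := by
  rw [LinearMap.trace_eq_matrix_trace ℂ (Matrix.stdBasis ℂ n n), trace]
  simp only [diag_apply, LinearMap.toMatrix_apply, LinearMap.mulLeft_apply, stdBasis_eq_single,
    Fintype.sum_prod_type]
  have h : ∀ (X : Matrix n n ℂ) i j, (Matrix.stdBasis ℂ n n).repr X (i, j) = X i j := by
    intro X i j
    simp [Matrix.stdBasis]
  simp [h, trace, Finset.mul_sum]

/-- The Capelli-type expression `∑ σ, sgn σ • y * ∏ i, p i * x (σ i) * q i`. -/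
def capelli {A : Type*} [NonUnitalRing A] [Module ℂ A] {d : ℕ} (y : A) (p q x : Fin d → A) : A :=
  ∑ σ : Equiv.Perm (Fin d), Equiv.Perm.sign σ •
    (List.ofFn fun i => p i * x (σ i) * q i).foldl (· * ·) y

theorem map_capelli {A B F : Type*} [NonUnitalRing A] [Module ℂ A] [NonUnitalRing B] [Module ℂ B]
    [FunLike F A B] [NonUnitalAlgHomClass F ℂ A B] (π : F) {d : ℕ} (y : A) (p q x : Fin d → A) :
    π (capelli y p q x) =
      capelli (π y) (fun i => π (p i)) (fun i => π (q i)) (fun i => π (x i)) := by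
  have hfold : ∀ (l : List A) (y : A), π (l.foldl (· * ·) y) = (l.map π).foldl (· * ·) (π y) := by
    intro l
    induction l with
    | nil => simp
    | cons a l ih => intro y; simp [ih]
  simp only [capelli, map_sum]
  refine Finset.sum_congr rfl fun σ _ => ?_
  rw [Units.smul_def, Units.smul_def, map_zsmul, hfold, List.map_ofFn]
  congr 3
  ext i
  simp

theorem exists_alternatingMap_eq_capelli {R : Type*} [Ring R] [Algebra ℂ R] {d : ℕ} (y : R)
    (p q : Fin d → R) : ∃ f : R [⋀^Fin d]→ₗ[ℂ] R, ∀ x, f x = capelli y p q x := by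
  let m : MultilinearMap ℂ (fun _ : Fin d => R) R :=
    (LinearMap.mulLeft ℂ y).compMultilinearMap
      ((MultilinearMap.mkPiAlgebraFin ℂ d R).compLinearMap fun i =>
        (LinearMap.mulLeft ℂ (p i)).comp (LinearMap.mulRight ℂ (q i)))
  refine ⟨MultilinearMap.alternatization m, fun x => ?_⟩
  rw [MultilinearMap.alternatization_apply, capelli]
  refine Finset.sum_congr rfl fun σ _ => ?_
  congr 1
  have : ∀ (l : List R) (y : R), l.foldl (· * ·) y = y * l.prod := by
    intro l
    induction l with
    | nil => simp
    | cons a l ih => intro y; simp [ih, mul_assoc]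
  rw [this]
  simp [m, mul_assoc]

-- Left multiplication by a on M_n has trace n · tr a. The left-hand side uses only products and
-- sums, so it can be formed inside a subalgebra of matrix-valued functions that does not contain
-- the function tr a.
open Matrix in
theorem sum_capelli_update {n : ℕ} (y : Matrix (Fin n) (Fin n) ℂ)
    (p q x : Fin (n * n) → Matrix (Fin n) (Fin n) ℂ) (a : Matrix (Fin n) (Fin n) ℂ) :
    ∑ i, capelli y p q (Function.update x i (a * x i)) = ((n : ℂ) * a.trace) • capelli y p q x := by
  obtain ⟨f, hf⟩ := exists_alternatingMap_eq_capelli y p q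
  have h := sum_map_update_eq_trace_smul
    ((Matrix.stdBasis ℂ (Fin n) (Fin n)).reindex finProdFinEquiv) f (LinearMap.mulLeft ℂ a) x
  rw [trace_mulLeft] at h
  simpa [hf] using h

-- Capelli expressions do not vanish identically on M_n: with matrix units as arguments, only the
-- identity permutation gives composable products throughout.
open Matrix in
theorem capelli_single {n : ℕ} (k : Fin n) :
    capelli (d := n * n) (Matrix.single k k (1 : ℂ))
      (fun i => Matrix.single k (finProdFinEquiv.symm i).1 1)
      (fun i => Matrix.single (finProdFinEquiv.symm i).2 k 1)
      (fun i => Matrix.single (finProdFinEquiv.symm i).1 (finProdFinEquiv.symm i).2 1) =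
    Matrix.single k k 1 := by
  have hfold : ∀ (l : List ℂ) (c : ℂ), (l.map (Matrix.single k k)).foldl (· * ·)
      (Matrix.single k k c) = Matrix.single k k (c * l.prod) := by
    intro l
    induction l with
    | nil => simp
    | cons a l ih => intro y; simp [ih, mul_assoc]
  have hterm : ∀ σ : Equiv.Perm (Fin (n * n)),
      (fun i => Matrix.single k (finProdFinEquiv.symm i).1 1
      * Matrix.single (finProdFinEquiv.symm (σ i)).1 (finProdFinEquiv.symm (σ i)).2 1
      * Matrix.single (finProdFinEquiv.symm i).2 k 1) = fun i => Matrix.single k k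
        (if i = σ i then (1 : ℂ) else 0) := by
    intro σ
    ext1 i
    by_cases h : i = σ i
    · rw [← h]; simp
    · rw [if_neg h]
      by_cases h1 : (finProdFinEquiv.symm i).1 = (finProdFinEquiv.symm (σ i)).1
      · have h2 : (finProdFinEquiv.symm (σ i)).2 ≠ (finProdFinEquiv.symm i).2 := fun h2 =>
          h (finProdFinEquiv.symm.injective (Prod.ext h1 h2.symm))
        rw [Matrix.mul_assoc, Matrix.single_mul_single_of_ne _ _ _ _ h2]
        simp
      · rw [Matrix.single_mul_single_of_ne _ _ _ _ h1]
        simp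
  have hofFn : ∀ c : Fin (n * n) → ℂ, (List.ofFn fun i => Matrix.single k k (c i)) =
      (List.ofFn c).map (Matrix.single k k) := fun c => by rw [List.map_ofFn]; rfl
  rw [capelli, Finset.sum_eq_single 1]
  · rw [hterm, hofFn, hfold]
    simp
  · intro σ _ hσ
    obtain ⟨i, hi⟩ : ∃ i, σ i ≠ i := by
      by_contra! h
      exact hσ (Equiv.ext h)
    rw [hterm, hofFn, hfold, one_mul, List.prod_ofFn,
      Finset.prod_eq_zero (Finset.mem_univ i) (if_neg (Ne.symm hi))]
    simp
  · simp

end SchurMult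

/-! ### Multiplying by functions of the traces, and approximate units at irreducible points. -/

namespace SchurMult

open scoped Matrix.Norms.L2Operator

/-- Here 0 ≤ c x*x ≤ 1 in the C*-order, so 1 − c x*x also lies between 0 and 1. -/
theorem norm_one_sub_star_mul_self_le {B : Type*} [CStarAlgebra B] {c : ℝ} (hc : 0 ≤ c) (x : B)
    (hx : c * ‖x‖ ^ 2 ≤ 1) : ‖1 - (c : ℂ) • (star x * x)‖ ≤ 1 := by
  let _ := CStarAlgebra.spectralOrder B
  have := CStarAlgebra.spectralOrderedRing B
  have hs : (c : ℂ) • (star x * x) = star ((Real.sqrt c : ℂ) • x) * ((Real.sqrt c : ℂ) • x) := by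
    rw [star_smul, smul_mul_smul_comm]
    congr 1
    simp only [RCLike.star_def, Complex.conj_ofReal]
    rw [← Complex.ofReal_mul, Real.mul_self_sqrt hc]
  have h0 : 0 ≤ (c : ℂ) • (star x * x) := by
    rw [hs]
    exact star_mul_self_nonneg _
  have h1 : ‖(c : ℂ) • (star x * x)‖ ≤ 1 := by
    rw [norm_smul, CStarRing.norm_star_mul_self, Complex.norm_real, Real.norm_of_nonneg hc]
    nlinarith
  have h2 := (CStarAlgebra.norm_le_one_iff_of_nonneg _ h0).1 h1
  exact (CStarAlgebra.norm_le_one_iff_of_nonneg _ (sub_nonneg.2 h2)).2 (sub_le_self _ h0)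

section Field

variable {A : Type*} [NonUnitalCStarAlgebra A] {Ω : Type*} {n : ℕ}
  (ρ : Ω → A →⋆ₙₐ[ℂ] Matrix (Fin n) (Fin n) ℂ)

theorem norm_map_le {B : Type*} [NonUnitalCStarAlgebra B] (π : A →⋆ₙₐ[ℂ] B) (a : A) :
    ‖π a‖ ≤ ‖a‖ := NonUnitalStarAlgHom.norm_apply_le π a

/-- The values of Capelli expressions in `n ^ 2` alternating variables span this subspace. -/
def capelliSpan (A : Type*) [NonUnitalRing A] [Module ℂ A] (n : ℕ) : Submodule ℂ A :=
  Submodule.span ℂ {j | ∃ y p q x, j = capelli (d := n * n) y p q x}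

/-- The Capelli identity is applied in all fibres at once: one element j' of `A` realises
multiplication by the function ω ↦ tr ρ_ω(a), and it stays in the span, so the operation can be
iterated. -/
theorem exists_mem_capelliSpan_map_eq_trace_smul (hn : n ≠ 0) {j : A} (hj : j ∈ capelliSpan A n)
    (a : A) : ∃ j' ∈ capelliSpan A n, ∀ ω, ρ ω j' = (ρ ω a).trace • ρ ω j := by
  induction hj using Submodule.span_induction with
  | mem j hj =>
    obtain ⟨y, p, q, x, rfl⟩ := hj
    refine ⟨(n : ℂ)⁻¹ • ∑ i, capelli y p q (Function.update x i (a * x i)),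
      Submodule.smul_mem _ _ (Submodule.sum_mem _ fun i _ => Submodule.subset_span
        ⟨_, _, _, _, rfl⟩), fun ω => ?_⟩
    have h := sum_capelli_update (ρ ω y) (fun i => ρ ω (p i)) (fun i => ρ ω (q i))
      (fun i => ρ ω (x i)) (ρ ω a)
    rw [map_smul, map_sum, map_capelli]
    have h2 : ∀ i, ρ ω (capelli y p q (Function.update x i (a * x i))) =
        capelli (ρ ω y) (fun i => ρ ω (p i)) (fun i => ρ ω (q i))
          (Function.update (fun i => ρ ω (x i)) i (ρ ω a * ρ ω (x i))) := by
      intro i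
      rw [map_capelli]
      congr 1
      ext1 l
      by_cases h : l = i
      · subst h; simp
      · simp [h]
    rw [Finset.sum_congr rfl fun i _ => h2 i, h, smul_smul, ← mul_assoc,
      inv_mul_cancel₀ (by exact_mod_cast hn), one_mul]
  | zero => exact ⟨0, Submodule.zero_mem _, by simp⟩
  | add x y _ _ hx hy =>
    obtain ⟨x', hx', hx⟩ := hx
    obtain ⟨y', hy', hy⟩ := hy
    exact ⟨x' + y', Submodule.add_mem _ hx' hy', fun ω => by simp [hx, hy]⟩
  | smul c x _ hx =>
    obtain ⟨x', hx', hx⟩ := hx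
    exact ⟨c • x', Submodule.smul_mem _ c hx', fun ω => by simp [hx, smul_comm c]⟩

/-- The trace function of each of the representations `ρ ω`. -/
def traceMap (ω : Ω) : A → ℂ := fun a => (ρ ω a).trace

/-- The element `j` may be multiplied, up to arbitrarily small errors, by every continuous function
of the traces of the representations. -/
def TraceAbsorbing (j : A) : Prop :=
  ∀ (q : C(Set.range (traceMap ρ), ℂ)) (ε : ℝ), 0 < ε → ∃ j' : A, ∀ ω,
    ‖ρ ω j' - q ⟨traceMap ρ ω, ω, rfl⟩ • ρ ω j‖ ≤ ε

variable {ρ}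

theorem TraceAbsorbing.add {j k : A} (hj : TraceAbsorbing ρ j) (hk : TraceAbsorbing ρ k) :
    TraceAbsorbing ρ (j + k) := by
  intro q ε hε
  obtain ⟨j', hj'⟩ := hj q (ε / 2) (by positivity)
  obtain ⟨k', hk'⟩ := hk q (ε / 2) (by positivity)
  refine ⟨j' + k', fun ω => ?_⟩
  rw [map_add, map_add, smul_add, add_sub_add_comm]
  exact (norm_add_le _ _).trans (by linarith [hj' ω, hk' ω])

theorem TraceAbsorbing.mul_left {j : A} (hj : TraceAbsorbing ρ j) (a : A) :
    TraceAbsorbing ρ (a * j) := by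
  intro q ε hε
  obtain ⟨j', hj'⟩ := hj q (ε / (‖a‖ + 1)) (by positivity)
  refine ⟨a * j', fun ω => ?_⟩
  rw [map_mul, map_mul, ← mul_smul_comm, ← mul_sub]
  calc _ ≤ ‖ρ ω a‖ * ‖ρ ω j' - q ⟨traceMap ρ ω, ω, rfl⟩ • ρ ω j‖ := norm_mul_le _ _
    _ ≤ (‖a‖ + 1) * (ε / (‖a‖ + 1)) := by
      gcongr
      · linarith [norm_map_le (ρ ω) a]
      · exact hj' ω
    _ = ε := by field_simp

theorem TraceAbsorbing.mul_right {j : A} (hj : TraceAbsorbing ρ j) (a : A) :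
    TraceAbsorbing ρ (j * a) := by
  intro q ε hε
  obtain ⟨j', hj'⟩ := hj q (ε / (‖a‖ + 1)) (by positivity)
  refine ⟨j' * a, fun ω => ?_⟩
  rw [map_mul, map_mul, ← smul_mul_assoc, ← sub_mul]
  calc _ ≤ ‖ρ ω j' - q ⟨traceMap ρ ω, ω, rfl⟩ • ρ ω j‖ * ‖ρ ω a‖ := norm_mul_le _ _
    _ ≤ (ε / (‖a‖ + 1)) * (‖a‖ + 1) := by
      gcongr
      · exact hj' ω
      · linarith [norm_map_le (ρ ω) a]
    _ = ε := by field_simp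

theorem TraceAbsorbing.smul {j : A} (hj : TraceAbsorbing ρ j) (c : ℂ) :
    TraceAbsorbing ρ (c • j) := by
  intro q ε hε
  obtain ⟨j', hj'⟩ := hj q (ε / (‖c‖ + 1)) (by positivity)
  refine ⟨c • j', fun ω => ?_⟩
  rw [map_smul, map_smul, smul_comm, ← smul_sub, norm_smul]
  calc _ ≤ (‖c‖ + 1) * (ε / (‖c‖ + 1)) := by
        gcongr
        · linarith
        · exact hj' ω
    _ = ε := by field_simp

theorem traceAbsorbing_zero : TraceAbsorbing ρ (0 : A) :=
  fun _ ε hε => ⟨0, fun ω => by simpa using hε.le⟩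

/-- The quasi-product, for which `1 - (j + k - j * k) = (1 - j) * (1 - k)`. -/
theorem TraceAbsorbing.circle {j k : A} (hj : TraceAbsorbing ρ j) (hk : TraceAbsorbing ρ k) :
    TraceAbsorbing ρ (j + k - j * k) := by
  have := (hj.add hk).add ((hj.mul_right k).smul (-1))
  simpa [sub_eq_add_neg] using this

theorem one_sub_map_circle (ω : Ω) (j k : A) :
    1 - ρ ω (j + k - j * k) = (1 - ρ ω j) * (1 - ρ ω k) := by
  rw [map_sub, map_add, map_mul]
  noncomm_ring

theorem exists_mem_capelliSpan_map_eq_one {ω : Ω} (hω : Function.Surjective (ρ ω)) :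
    ∃ j ∈ capelliSpan A n, ρ ω j = 1 := by
  choose s hs using hω
  refine ⟨∑ k : Fin n, capelli (d := n * n) (s (Matrix.single k k 1))
      (fun i => s (Matrix.single k (finProdFinEquiv.symm i).1 1))
      (fun i => s (Matrix.single (finProdFinEquiv.symm i).2 k 1))
      (fun i => s (Matrix.single (finProdFinEquiv.symm i).1 (finProdFinEquiv.symm i).2 1)),
    Submodule.sum_mem _ fun k _ => Submodule.subset_span ⟨_, _, _, _, rfl⟩, ?_⟩
  rw [map_sum]
  simp only [map_capelli, hs, capelli_single]
  ext i j
  rw [Matrix.sum_apply]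
  by_cases h : i = j
  · subst h
    simp [Matrix.single_apply]
  · rw [Matrix.one_apply_ne h]
    refine Finset.sum_eq_zero fun k _ => ?_
    rw [Matrix.single_apply, if_neg]
    rintro ⟨rfl, rfl⟩
    exact h rfl

variable [TopologicalSpace Ω]

theorem continuous_traceMap (hρ : ∀ a, Continuous fun ω => ρ ω a) : Continuous (traceMap ρ) :=
  continuous_pi fun a => (hρ a).matrix_trace

variable [CompactSpace Ω]

/-- Stone–Weierstrass on the compact space of trace functions. The coordinates y ↦ y(a) separate
points by construction and are closed under conjugation, since the conjugate of tr ρ_ω(a) is tr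
ρ_ω(a*). -/
theorem traceAbsorbing_of_mem_capelliSpan (hn : n ≠ 0) (hρ : ∀ a, Continuous fun ω => ρ ω a)
    {j : A} (hj : j ∈ capelliSpan A n) : TraceAbsorbing ρ j := by
  have : CompactSpace (Set.range (traceMap ρ)) :=
    isCompact_iff_compactSpace.1 (isCompact_range (continuous_traceMap hρ))
  let coord : A → C(Set.range (traceMap ρ), ℂ) := fun a =>
    ⟨fun y => y.1 a, (continuous_apply a).comp continuous_subtype_val⟩
  have hstar : star (Set.range coord) ⊆ Set.range coord := by
    intro f hf
    obtain ⟨a, ha⟩ := hf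
    refine ⟨star a, ?_⟩
    rw [← star_star f, ← ha]
    ext y
    obtain ⟨_, ω, rfl⟩ := y
    simp [coord, traceMap, map_star, Matrix.star_eq_conjTranspose, Matrix.trace_conjTranspose]
  -- Polynomials in the traces act exactly; only the passage to continuous functions costs an error.
  have hpoly : ∀ q ∈ Algebra.adjoin ℂ (Set.range coord), ∀ j ∈ capelliSpan A n,
      ∃ j' ∈ capelliSpan A n, ∀ ω, ρ ω j' = q ⟨traceMap ρ ω, ω, rfl⟩ • ρ ω j := by
    intro q hq
    induction hq using Algebra.adjoin_induction with
    | mem q hq =>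
      obtain ⟨a, rfl⟩ := hq
      intro j hj
      exact exists_mem_capelliSpan_map_eq_trace_smul ρ hn hj a
    | algebraMap c =>
      intro j hj
      exact ⟨c • j, Submodule.smul_mem _ c hj, fun ω => by simp⟩
    | add p q _ _ hp hq =>
      intro j hj
      obtain ⟨x, hx, hx'⟩ := hp j hj
      obtain ⟨y, hy, hy'⟩ := hq j hj
      exact ⟨x + y, Submodule.add_mem _ hx hy, fun ω => by simp [hx', hy', add_smul]⟩
    | mul p q _ _ hp hq =>
      intro j hj
      obtain ⟨x, hx, hx'⟩ := hq j hj
      obtain ⟨y, hy, hy'⟩ := hp x hx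
      exact ⟨y, hy, fun ω => by simp [hx', hy', mul_smul]⟩
  have hdense := ContinuousMap.starSubalgebra_topologicalClosure_eq_top_of_separatesPoints
    (StarAlgebra.adjoin ℂ (Set.range coord)) (by
      intro y z hyz
      obtain ⟨a, ha⟩ : ∃ a, y.1 a ≠ z.1 a := by
        by_contra! h
        exact hyz (Subtype.ext (funext h))
      exact ⟨_, ⟨coord a, StarAlgebra.subset_adjoin ℂ _ ⟨a, rfl⟩, rfl⟩, ha⟩)
  intro q ε hε
  have hq : q ∈ closure ((StarAlgebra.adjoin ℂ (Set.range coord) :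
      StarSubalgebra ℂ C(Set.range (traceMap ρ), ℂ)) : Set C(Set.range (traceMap ρ), ℂ)) := by
    rw [← StarSubalgebra.topologicalClosure_coe, hdense]
    trivial
  obtain ⟨p, hp, hpq⟩ := Metric.mem_closure_iff.1 hq (ε / (‖j‖ + 1)) (by positivity)
  have hp' : p ∈ Algebra.adjoin ℂ (Set.range coord) := by
    have : p ∈ (StarAlgebra.adjoin ℂ (Set.range coord)).toSubalgebra := hp
    rwa [StarAlgebra.adjoin_toSubalgebra, Set.union_eq_left.2 hstar] at this
  obtain ⟨j', -, hj'⟩ := hpoly p hp' j hj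
  refine ⟨j', fun ω => ?_⟩
  rw [hj', ← sub_smul, norm_smul]
  calc _ ≤ (ε / (‖j‖ + 1)) * (‖j‖ + 1) := by
        gcongr
        · rw [dist_comm, dist_eq_norm] at hpq
          exact ((p - q).norm_coe_le_norm ⟨traceMap ρ ω, ω, rfl⟩).trans hpq.le
        · linarith [norm_map_le (ρ ω) j]
    _ = ε := by field_simp

/-- Approximate units on a compact set of points where the representations are irreducible. -/
theorem exists_traceAbsorbing_norm_one_sub_le (hn : n ≠ 0) (hρ : ∀ a, Continuous fun ω => ρ ω a)
    {L : Set Ω} (hL : IsCompact L) (hsurj : ∀ ω ∈ L, Function.Surjective (ρ ω))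
    {η : ℝ} (hη : 0 < η) : ∃ e : A, TraceAbsorbing ρ e ∧ (∀ ω, ‖1 - ρ ω e‖ ≤ 1) ∧
      ∀ ω ∈ L, ‖1 - ρ ω e‖ ≤ η := by
  have : Nonempty (Fin n) := ⟨⟨0, Nat.pos_of_ne_zero hn⟩⟩
  have hone : ‖(1 : Matrix (Fin n) (Fin n) ℂ)‖ = 1 := CStarRing.norm_one
  refine hL.induction_on (p := fun L => ∃ e : A, TraceAbsorbing ρ e ∧ (∀ ω, ‖1 - ρ ω e‖ ≤ 1) ∧
      ∀ ω ∈ L, ‖1 - ρ ω e‖ ≤ η) ?_ ?_ ?_ ?_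
  · exact ⟨0, traceAbsorbing_zero, by simp [hone], by simp⟩
  · rintro s t hst ⟨e, h1, h2, h3⟩
    exact ⟨e, h1, h2, fun ω hω => h3 ω (hst hω)⟩
  · rintro s t ⟨e, h1, h2, h3⟩ ⟨f, h1', h2', h3'⟩
    -- The quasi-product multiplies the defects 1 − e and 1 − f. Both are contractive everywhere, so
    -- the product is small wherever one of them is.
    refine ⟨_, h1.circle h1', fun ω => ?_, fun ω hω => ?_⟩
    · rw [one_sub_map_circle]
      exact (norm_mul_le _ _).trans (mul_le_one₀ (h2 ω) (norm_nonneg _) (h2' ω))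
    · rw [one_sub_map_circle]
      refine (norm_mul_le _ _).trans ?_
      rcases hω with h | h
      · calc _ ≤ η * 1 := mul_le_mul (h3 ω h) (h2' ω) (norm_nonneg _) hη.le
          _ = η := mul_one _
      · calc _ ≤ 1 * η := mul_le_mul (h2 ω) (h3' ω h) (norm_nonneg _) zero_le_one
          _ = η := one_mul _
  · intro ω₀ hω₀
    obtain ⟨j, hj, hj1⟩ := exists_mem_capelliSpan_map_eq_one (hsurj ω₀ hω₀)
    have hj1' : 1 ≤ ‖j‖ := by
      have := norm_map_le (ρ ω₀) j
      rwa [hj1, hone] at this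
    -- With this scaling 0 ≤ ρ_ω(h₀) ≤ 1 in every fibre, while 1 − ρ_ω₀(h₀) is the scalar 1 − c < 1.
    -- Powers of 1 − h₀ are thus small at ω₀, and near it by continuity.
    set c : ℝ := (‖j‖ ^ 2)⁻¹ with hc
    have hc0 : 0 < c := by positivity
    have hc1 : c ≤ 1 := inv_le_one_of_one_le₀ (by nlinarith)
    let h₀ : A := (c : ℂ) • (star j * j)
    have hh₀ : TraceAbsorbing ρ h₀ :=
      ((traceAbsorbing_of_mem_capelliSpan hn hρ hj).mul_left (star j)).smul _
    have hρh : ∀ ω, 1 - ρ ω h₀ = 1 - (c : ℂ) • (star (ρ ω j) * ρ ω j) := fun ω => by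
      simp only [h₀]
      rw [map_smul, map_mul, map_star]
    have hle : ∀ ω, ‖1 - ρ ω h₀‖ ≤ 1 := by
      intro ω
      rw [hρh]
      refine norm_one_sub_star_mul_self_le hc0.le _ ?_
      rw [hc, inv_mul_le_iff₀ (by positivity), mul_one]
      gcongr
      exact norm_map_le _ _
    have hpow : ∀ N : ℕ, ∃ e : A, TraceAbsorbing ρ e ∧ ∀ ω, 1 - ρ ω e = (1 - ρ ω h₀) ^ N := by
      intro N
      induction N with
      | zero => exact ⟨0, traceAbsorbing_zero, by simp⟩
      | succ N ih =>
        obtain ⟨e, he, he'⟩ := ih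
        exact ⟨_, he.circle hh₀, fun ω => by rw [one_sub_map_circle, he', pow_succ]⟩
    have h1c : ‖1 - ρ ω₀ h₀‖ = 1 - c := by
      rw [hρh, hj1]
      have : (1 : Matrix (Fin n) (Fin n) ℂ) - (c : ℂ) • (star 1 * 1) = ((1 - c : ℝ) : ℂ) • 1 := by
        rw [star_one, mul_one, Complex.ofReal_sub, sub_smul, Complex.ofReal_one, one_smul]
      rw [this, norm_smul, hone, mul_one, Complex.norm_real, Real.norm_of_nonneg (by linarith)]
    obtain ⟨N, hN⟩ := exists_pow_lt_of_lt_one hη (by linarith : 1 - c < 1)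
    obtain ⟨e, he, he'⟩ := hpow N
    have hcont : Continuous fun ω => ‖1 - ρ ω e‖ := (continuous_const.sub (hρ e)).norm
    have hlt : ‖1 - ρ ω₀ e‖ < η := by
      rw [he']
      refine (norm_pow_le _ _).trans_lt ?_
      rwa [h1c]
    refine ⟨{ω | ‖1 - ρ ω e‖ < η}, mem_nhdsWithin_of_mem_nhds
      ((isOpen_lt hcont continuous_const).mem_nhds hlt), e, he, fun ω => ?_,
      fun ω hω => le_of_lt hω⟩
    rw [he']
    exact (norm_pow_le _ _).trans (pow_le_one₀ (norm_nonneg _) (hle ω))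

end Field

end SchurMult

/-! ### Finite-rank approximation near the irreducible points. -/

namespace SchurMult

open scoped Matrix.Norms.L2Operator

-- The operator norm is at most the Hilbert–Schmidt norm. This lets the trace of z*z control ρ_ω(z),
-- so neighbourhoods in the space of traces suffice.
open Matrix in
theorem sq_norm_le_norm_trace_star_mul_self {n : ℕ} (X : Matrix (Fin n) (Fin n) ℂ) :
    ‖X‖ ^ 2 ≤ ‖(star X * X).trace‖ := by
  set S : ℝ := ∑ i, ∑ j, ‖X i j‖ ^ 2 with hS
  have hS0 : 0 ≤ S := by positivity
  have htr : (star X * X).trace = (S : ℂ) := by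
    simp only [trace, diag_apply, mul_apply, star_apply, hS, Complex.ofReal_sum]
    rw [Finset.sum_comm]
    refine Finset.sum_congr rfl fun i _ => Finset.sum_congr rfl fun j _ => ?_
    rw [RCLike.star_def, RCLike.conj_mul]
    simp
  have hbd : ‖X‖ ≤ Real.sqrt S := by
    rw [cstar_norm_def]
    refine ContinuousLinearMap.opNorm_le_bound _ (Real.sqrt_nonneg _) fun v => ?_
    rw [EuclideanSpace.norm_eq, EuclideanSpace.norm_eq, ← Real.sqrt_mul hS0]
    refine Real.sqrt_le_sqrt ?_
    rw [hS, Finset.sum_mul]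
    refine Finset.sum_le_sum fun i _ => ?_
    rw [ofLp_toEuclideanCLM, mulVec, dotProduct]
    calc ‖∑ j, X i j * v j‖ ^ 2 ≤ (∑ j, ‖X i j‖ * ‖v j‖) ^ 2 := by
          gcongr
          refine (norm_sum_le _ _).trans (le_of_eq ?_)
          simp
      _ ≤ _ := Finset.sum_mul_sq_le_sq_mul_sq _ _ _
  rw [htr, Complex.norm_real, Real.norm_of_nonneg hS0]
  calc ‖X‖ ^ 2 ≤ Real.sqrt S ^ 2 := by gcongr
    _ = S := Real.sq_sqrt hS0

section Field

variable {A : Type*} [NonUnitalCStarAlgebra A] {Ω : Type*} {n : ℕ}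
  {ρ : Ω → A →⋆ₙₐ[ℂ] Matrix (Fin n) (Fin n) ℂ}

/-- The representations are contractive, hence equicontinuous in a, which upgrades separate to joint
continuity. -/
theorem continuous_eval_field [TopologicalSpace Ω] (hρ : ∀ a, Continuous fun ω => ρ ω a) :
    Continuous fun p : Ω × A => ρ p.1 p.2 := by
  refine continuous_iff_continuousAt.2 fun ⟨ω₀, a₀⟩ => ?_
  rw [ContinuousAt, tendsto_iff_norm_sub_tendsto_zero]
  have h1 : Filter.Tendsto (fun p : Ω × A => ‖p.2 - a₀‖ + ‖ρ p.1 a₀ - ρ ω₀ a₀‖)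
      (nhds (ω₀, a₀)) (nhds 0) := by
    have : Continuous fun p : Ω × A => ‖p.2 - a₀‖ + ‖ρ p.1 a₀ - ρ ω₀ a₀‖ :=
      ((continuous_snd.sub continuous_const).norm).add
        ((((hρ a₀).comp continuous_fst).sub continuous_const).norm)
    simpa using this.tendsto (ω₀, a₀)
  refine squeeze_zero (fun _ => norm_nonneg _) (fun p => ?_) h1
  calc ‖ρ p.1 p.2 - ρ ω₀ a₀‖ = ‖ρ p.1 (p.2 - a₀) + (ρ p.1 a₀ - ρ ω₀ a₀)‖ := by
        rw [map_sub]; congr 1; abel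
    _ ≤ _ := (norm_add_le _ _).trans (by gcongr; exact norm_map_le _ _)

theorem continuous_eval_traceMap :
    Continuous fun p : Set.range (traceMap ρ) × A => p.1.1 p.2 := by
  let tr := LinearMap.toContinuousLinearMap (Matrix.traceLinearMap (Fin n) ℂ ℂ)
  have hLip : ∀ (y : Set.range (traceMap ρ)) (a b : A), ‖y.1 a - y.1 b‖ ≤ ‖tr‖ * ‖a - b‖ := by
    rintro ⟨_, ω, rfl⟩ a b
    have h1 : traceMap ρ ω a - traceMap ρ ω b = tr (ρ ω (a - b)) := by
      rw [map_sub, map_sub]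
      rfl
    rw [h1]
    exact (tr.le_opNorm _).trans (by gcongr; exact norm_map_le _ _)
  refine continuous_iff_continuousAt.2 fun ⟨y₀, a₀⟩ => ?_
  rw [ContinuousAt, tendsto_iff_norm_sub_tendsto_zero]
  have h1 : Filter.Tendsto (fun p : Set.range (traceMap ρ) × A =>
      ‖tr‖ * ‖p.2 - a₀‖ + ‖p.1.1 a₀ - y₀.1 a₀‖) (nhds (y₀, a₀)) (nhds 0) := by
    have : Continuous fun p : Set.range (traceMap ρ) × A =>
        ‖tr‖ * ‖p.2 - a₀‖ + ‖p.1.1 a₀ - y₀.1 a₀‖ :=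
      (continuous_const.mul (continuous_snd.sub continuous_const).norm).add
        ((((continuous_apply a₀).comp (continuous_subtype_val.comp continuous_fst)).sub
          continuous_const).norm)
    simpa using this.tendsto (y₀, a₀)
  refine squeeze_zero (fun _ => norm_nonneg _) (fun p => ?_) h1
  calc ‖p.1.1 p.2 - y₀.1 a₀‖ = ‖(p.1.1 p.2 - p.1.1 a₀) + (p.1.1 a₀ - y₀.1 a₀)‖ := by
        congr 1; abel
    _ ≤ _ := (norm_add_le _ _).trans (by gcongr; exact hLip _ _ _)

variable (ρ) in
/-- The matrix coefficients of a representation, as bounded functionals. -/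
noncomputable def coeffCLM (ω : Ω) (k l : Fin n) : A →L[ℂ] ℂ :=
  (LinearMap.toContinuousLinearMap (Matrix.entryLinearMap ℂ ℂ k l)).comp
    (LinearMap.mkContinuous (ρ ω : A →ₗ[ℂ] Matrix (Fin n) (Fin n) ℂ) 1
      fun a => by rw [one_mul]; exact norm_map_le (ρ ω) a)

theorem coeffCLM_apply (ω : Ω) (k l : Fin n) (a : A) : coeffCLM ρ ω k l a = ρ ω a k l := rfl

theorem finiteDimensional_range_sum_smulRight {ι E : Type*} [Fintype ι] [NormedAddCommGroup E]
    [NormedSpace ℂ E] (c : ι → E →L[ℂ] ℂ) (w : ι → E) :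
    FiniteDimensional ℂ (LinearMap.range (∑ i, (c i).smulRight (w i) : E →L[ℂ] E).toLinearMap) := by
  have : FiniteDimensional ℂ (Submodule.span ℂ (Set.range w)) :=
    FiniteDimensional.span_of_finite ℂ (Set.finite_range w)
  refine Submodule.finiteDimensional_of_le (S₂ := Submodule.span ℂ (Set.range w)) ?_
  rintro _ ⟨a, rfl⟩
  simp only [ContinuousLinearMap.coe_coe, _root_.sum_apply,
    ContinuousLinearMap.smulRight_apply]
  exact Submodule.sum_mem _ fun i _ => Submodule.smul_mem _ _ (Submodule.subset_span ⟨i, rfl⟩)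

variable [TopologicalSpace Ω] [CompactSpace Ω]

/-- Finite rank approximation on a compact set which is small wherever the representations fail to
be irreducible. -/
theorem exists_finiteRank_approx_of_small (hn : n ≠ 0) (hρ : ∀ a, Continuous fun ω => ρ ω a)
    {K : Set A} (hK : IsCompact K) {ε : ℝ} (hε : 0 < ε)
    (hsmall : ∀ b ∈ K, ∀ ω, ¬ Function.Surjective (ρ ω) → ‖ρ ω b‖ ≤ ε) :
    ∃ θ : A →L[ℂ] A, FiniteDimensional ℂ (LinearMap.range θ.toLinearMap) ∧
      ∀ b ∈ K, ∀ ω, ‖ρ ω (b - θ b)‖ ≤ 9 * ε := by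
  classical
  have : Nonempty (Fin n) := ⟨⟨0, Nat.pos_of_ne_zero hn⟩⟩
  have hone : ‖(1 : Matrix (Fin n) (Fin n) ℂ)‖ = 1 := CStarRing.norm_one
  have hYc : CompactSpace (Set.range (traceMap ρ)) :=
    isCompact_iff_compactSpace.1 (isCompact_range (continuous_traceMap hρ))
  let τ : Ω → Set.range (traceMap ρ) := fun ω => ⟨traceMap ρ ω, ω, rfl⟩
  have hτ : Continuous τ := (continuous_traceMap hρ).subtype_mk _
  obtain ⟨M, hM0, hM⟩ : ∃ M : ℝ, 0 < M ∧ ∀ b ∈ K, ‖b‖ ≤ M := by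
    obtain ⟨M, hM⟩ := hK.isBounded.exists_norm_le
    exact ⟨max M 1, by positivity, fun b hb => (hM b hb).trans (le_max_left _ _)⟩
  -- The closed condition at level 2ε makes `L` compact, and the gap above ε forces every point of
  -- `L` to be irreducible. Off `L` everything in `K` is small.
  let L : Set Ω := Prod.fst '' {p : Ω × A | p ∈ Set.univ ×ˢ K ∧ 2 * ε ≤ ‖ρ p.1 p.2‖}
  have hL : IsCompact L :=
    ((isCompact_univ.prod hK).inter_right
      (isClosed_le continuous_const (continuous_eval_field hρ).norm)).image continuous_fst
  have hLsurj : ∀ ω ∈ L, Function.Surjective (ρ ω) := by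
    rintro _ ⟨⟨ω, b⟩, ⟨⟨-, hb⟩, h⟩, rfl⟩
    by_contra hcon
    have := hsmall b hb ω hcon
    dsimp only at h
    linarith
  have hLc : ∀ ω, ω ∉ L → ∀ b ∈ K, ‖ρ ω b‖ ≤ 2 * ε := by
    intro ω hω b hb
    by_contra! h
    exact hω ⟨(ω, b), ⟨⟨trivial, hb⟩, h.le⟩, rfl⟩
  obtain ⟨e, he, he1, heL⟩ := exists_traceAbsorbing_norm_one_sub_le hn hρ hL hLsurj
    (div_pos hε hM0)
  have he2 : ∀ ω, ‖ρ ω e‖ ≤ 2 := by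
    intro ω
    calc ‖ρ ω e‖ = ‖1 - (1 - ρ ω e)‖ := by rw [sub_sub_cancel]
      _ ≤ ‖(1 : Matrix (Fin n) (Fin n) ℂ)‖ + ‖1 - ρ ω e‖ := norm_sub_le _ _
      _ ≤ 2 := by rw [hone]; linarith [he1 ω]
  have hx : ∀ ω : Ω, ∃ x : Fin n → Fin n → A, ω ∈ L → ∀ k l, ρ ω (x k l) = Matrix.single k l 1 := by
    intro ω
    by_cases h : ω ∈ L
    · choose s hs using hLsurj ω h
      exact ⟨fun k l => s (Matrix.single k l 1), fun _ k l => hs _⟩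
    · exact ⟨0, fun h' => absurd h' h⟩
  choose x hx using hx
  -- The error of the finite-rank interpolation of b at t; it vanishes in the fibre over t.
  let z : Ω → A → A := fun t b => b - ∑ k, ∑ l, coeffCLM ρ t k l b • x t k l
  have hzc : ∀ t, Continuous (z t) := fun t => by
    refine continuous_id.sub (continuous_finsetSum _ fun k _ =>
      continuous_finsetSum _ fun l _ => ?_)
    exact (coeffCLM ρ t k l).continuous.smul continuous_const
  have hz0 : ∀ t ∈ L, ∀ b, ρ t (z t b) = 0 := by
    intro t ht b
    simp only [z, map_sub, map_sum, map_smul, hx t ht, coeffCLM_apply]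
    rw [sub_eq_zero]
    conv_lhs => rw [Matrix.matrix_eq_sum_single (ρ t b)]
    simp [Matrix.smul_single]
  -- The traces for which the interpolation at t is good, uniformly over `K`. Compactness of `K` is
  -- what puts `τ t` in the interior.
  let U : Ω → Set (Set.range (traceMap ρ)) := fun t =>
    interior {y | ∀ b ∈ K, ‖y.1 (star (z t b) * z t b)‖ < ε ^ 2}
  have hUmem : ∀ t ∈ L, τ t ∈ U t := by
    intro t ht
    rw [mem_interior_iff_mem_nhds]
    refine hK.eventually_forall_of_forall_eventually (x₀ := τ t)
      (P := fun y b => ‖y.1 (star (z t b) * z t b)‖ < ε ^ 2) fun b hb => ?_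
    have hc : Continuous fun p : Set.range (traceMap ρ) × A =>
        ‖p.1.1 (star (z t p.2) * z t p.2)‖ :=
      (continuous_eval_traceMap.comp (continuous_fst.prodMk
        (((hzc t).comp continuous_snd).star.mul ((hzc t).comp continuous_snd)))).norm
    refine (isOpen_lt hc continuous_const).mem_nhds ?_
    have : traceMap ρ t (star (z t b) * z t b) = 0 := by
      simp [traceMap, map_mul, hz0 t ht]
    simp only [Set.mem_ofPred_eq, τ, this, norm_zero]
    positivity
  have hUsmall : ∀ t ω, τ ω ∈ U t → ∀ b ∈ K, ‖ρ ω (z t b)‖ ≤ ε := by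
    intro t ω h b hb
    have h1 : ‖traceMap ρ ω (star (z t b) * z t b)‖ < ε ^ 2 := interior_subset h b hb
    have h2 := sq_norm_le_norm_trace_star_mul_self (ρ ω (z t b))
    rw [← map_star, ← map_mul] at h2
    exact (sq_le_sq₀ (norm_nonneg _) hε.le).1 (h2.trans h1.le)
  obtain ⟨T, hT⟩ := (hL.image hτ).elim_finite_subcover (fun t : L => U (t : Ω))
    (fun _ => isOpen_interior) (by
      rintro _ ⟨t, ht, rfl⟩
      exact Set.mem_iUnion.2 ⟨⟨t, ht⟩, hUmem t ht⟩)
  obtain ⟨f, hf⟩ := PartitionOfUnity.exists_isSubordinate (hL.image hτ).isClosed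
    (fun t : T => U (t : L)) (fun _ => isOpen_interior) (by
      refine hT.trans ?_
      intro y hy
      simp only [Set.mem_iUnion] at hy ⊢
      obtain ⟨t, ht, hy⟩ := hy
      exact ⟨⟨t, ht⟩, hy⟩)
  let c : T × Fin n × Fin n → A →L[ℂ] ℂ := fun i => coeffCLM ρ i.1 i.2.1 i.2.2
  obtain ⟨δ, hδ0, hδ⟩ : ∃ δ : ℝ, 0 < δ ∧ (∑ i, ‖c i‖ * M) * δ ≤ ε := by
    have h0 : 0 ≤ ∑ i, ‖c i‖ * M := by positivity
    refine ⟨ε / (1 + ∑ i, ‖c i‖ * M), by positivity, ?_⟩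
    rw [mul_div_assoc', div_le_iff₀ (by positivity)]
    nlinarith
  -- The cut-offs `f` are functions of the trace, so `e` absorbs them: each f_t · x_{kl} · e is
  -- realised in `A` up to δ.
  have hw : ∀ i : T × Fin n × Fin n, ∃ w : A, ∀ ω,
      ‖ρ ω w - ((f i.1 (τ ω) : ℝ) : ℂ) • ρ ω (x i.1 i.2.1 i.2.2 * e)‖ ≤ δ := by
    intro i
    exact (he.mul_left (x i.1 i.2.1 i.2.2))
      ⟨fun y => ((f i.1 y : ℝ) : ℂ), Complex.continuous_ofReal.comp (f i.1).continuous⟩ δ hδ0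
  choose w hw using hw
  refine ⟨∑ i, (c i).smulRight (w i), finiteDimensional_range_sum_smulRight c w, ?_⟩
  intro b hb ω
  set s : ℝ := ∑ t, f t (τ ω) with hs
  have hs0 : 0 ≤ s := Finset.sum_nonneg fun t _ => f.nonneg t _
  have hs1 : s ≤ 1 := by
    have := f.sum_le_one (τ ω)
    rwa [finsum_eq_sum_of_fintype] at this
  have hsL : ω ∈ L → s = 1 := by
    intro h
    have := f.sum_eq_one (x := τ ω) ⟨ω, h, rfl⟩
    rwa [finsum_eq_sum_of_fintype] at this
  -- The four errors: `e` is not a unit (2ε), the partition need not sum to 1 off `L` (4ε), the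
  -- local interpolation error (2ε), and the realisation of the cut-offs in `A` (ε).
  have hdecomp : ρ ω (b - (∑ i, (c i).smulRight (w i) : A →L[ℂ] A) b) =
      ρ ω b * (1 - ρ ω e) + ((1 - s : ℝ) : ℂ) • (ρ ω b * ρ ω e)
      + ∑ t : T, ((f t (τ ω) : ℝ) : ℂ) • (ρ ω (z (t : L) b) * ρ ω e)
      - ∑ i, c i b • (ρ ω (w i) - ((f i.1 (τ ω) : ℝ) : ℂ) • ρ ω (x i.1 i.2.1 i.2.2 * e)) := by
    have h1 : ∑ t : T, ((f t (τ ω) : ℝ) : ℂ) • (ρ ω (z (t : L) b) * ρ ω e) =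
        (s : ℂ) • (ρ ω b * ρ ω e) -
          ∑ i, c i b • ((f i.1 (τ ω) : ℝ) : ℂ) • ρ ω (x i.1 i.2.1 i.2.2 * e) := by
      rw [Fintype.sum_prod_type, hs, Complex.ofReal_sum, Finset.sum_smul,
        ← Finset.sum_sub_distrib]
      refine Finset.sum_congr rfl fun t _ => ?_
      simp only [z, map_sub, sub_mul, smul_sub, map_sum, map_smul, map_mul]
      rw [Fintype.sum_prod_type, Finset.sum_mul, Finset.smul_sum]
      congr 1
      refine Finset.sum_congr rfl fun k _ => ?_
      rw [Finset.sum_mul, Finset.smul_sum]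
      refine Finset.sum_congr rfl fun l _ => ?_
      rw [smul_mul_assoc, smul_comm]
    rw [h1]
    simp only [smul_sub, Finset.sum_sub_distrib, map_sub, _root_.sum_apply,
      ContinuousLinearMap.smulRight_apply, map_sum, map_smul, mul_sub, mul_one,
      Complex.ofReal_sub, Complex.ofReal_one, sub_smul, one_smul]
    abel
  have hb1 : ‖ρ ω b‖ ≤ M := (norm_map_le _ _).trans (hM b hb)
  have e1 : ‖ρ ω b * (1 - ρ ω e)‖ ≤ 2 * ε := by
    refine (norm_mul_le _ _).trans ?_
    by_cases h : ω ∈ L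
    · calc _ ≤ M * (ε / M) := mul_le_mul hb1 (heL ω h) (norm_nonneg _) hM0.le
        _ = ε := by field_simp
        _ ≤ 2 * ε := by linarith
    · calc _ ≤ (2 * ε) * 1 := mul_le_mul (hLc ω h b hb) (he1 ω) (norm_nonneg _) (by positivity)
        _ = 2 * ε := mul_one _
  have e2 : ‖((1 - s : ℝ) : ℂ) • (ρ ω b * ρ ω e)‖ ≤ 4 * ε := by
    by_cases h : ω ∈ L
    · rw [hsL h]; simp; positivity
    · rw [norm_smul, Complex.norm_real, Real.norm_of_nonneg (by linarith)]
      calc _ ≤ 1 * ((2 * ε) * 2) := by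
            refine mul_le_mul (by linarith) ?_ (norm_nonneg _) zero_le_one
            exact (norm_mul_le _ _).trans
              (mul_le_mul (hLc ω h b hb) (he2 ω) (norm_nonneg _) (by positivity))
        _ = 4 * ε := by ring
  have e3 : ‖∑ t : T, ((f t (τ ω) : ℝ) : ℂ) • (ρ ω (z (t : L) b) * ρ ω e)‖ ≤ 2 * ε := by
    calc _ ≤ ∑ t : T, f t (τ ω) * (ε * 2) := by
          refine norm_sum_le_of_le _ fun t _ => ?_
          rw [norm_smul, Complex.norm_real, Real.norm_of_nonneg (f.nonneg t _)]
          by_cases h : f t (τ ω) = 0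
          · simp [h]
          · refine mul_le_mul_of_nonneg_left ?_ (f.nonneg t _)
            have hU : τ ω ∈ U (t : L) := hf t (subset_tsupport _ h)
            exact (norm_mul_le _ _).trans
              (mul_le_mul (hUsmall _ ω hU b hb) (he2 ω) (norm_nonneg _) hε.le)
      _ = s * (ε * 2) := by rw [hs, Finset.sum_mul]
      _ ≤ 1 * (ε * 2) := by gcongr
      _ = 2 * ε := by ring
  have e4 : ‖∑ i, c i b • (ρ ω (w i) - ((f i.1 (τ ω) : ℝ) : ℂ) •
      ρ ω (x i.1 i.2.1 i.2.2 * e))‖ ≤ ε := by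
    calc _ ≤ ∑ i, (‖c i‖ * M) * δ := by
          refine norm_sum_le_of_le _ fun i _ => ?_
          rw [norm_smul]
          refine mul_le_mul ?_ (hw i ω) (norm_nonneg _) (by positivity)
          exact ((c i).le_opNorm b).trans (by gcongr; exact hM b hb)
      _ ≤ ε := by rwa [← Finset.sum_mul]
  rw [hdecomp]
  refine (norm_sub_le _ _).trans ?_
  have := norm_add₃_le (a := ρ ω b * (1 - ρ ω e)) (b := ((1 - s : ℝ) : ℂ) • (ρ ω b * ρ ω e))
    (c := ∑ t : T, ((f t (τ ω) : ℝ) : ℂ) • (ρ ω (z (t : L) b) * ρ ω e))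
  linarith

end Field

end SchurMult

/-! ### The approximation property, by induction on the matrix size. -/

namespace SchurMult

open scoped Matrix.Norms.L2Operator

section Induction

open Matrix

/-- The compression of a representation by a partial isometry whose range projection commutes with
it. -/
noncomputable def compression {A : Type*} [NonUnitalCStarAlgebra A] {m k : ℕ}
    (π : A →⋆ₙₐ[ℂ] Matrix (Fin m) (Fin m) ℂ) (V : Matrix (Fin m) (Fin k) ℂ)
    (hV : V * Vᴴ * V = V) (hc : ∀ b, V * Vᴴ * π b = π b * (V * Vᴴ)) :
    A →⋆ₙₐ[ℂ] Matrix (Fin k) (Fin k) ℂ where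
  toFun a := Vᴴ * π a * V
  map_smul' c a := by simp
  map_zero' := by simp
  map_add' a b := by simp [Matrix.mul_add, Matrix.add_mul]
  map_mul' a b := by
    calc Vᴴ * π (a * b) * V = Vᴴ * π a * (π b * (V * Vᴴ * V)) := by
          rw [hV, map_mul]; simp only [Matrix.mul_assoc]
      _ = Vᴴ * π a * (π b * (V * Vᴴ) * V) := by simp only [Matrix.mul_assoc]
      _ = Vᴴ * π a * V * (Vᴴ * π b * V) := by rw [← hc]; simp only [Matrix.mul_assoc]
  map_star' a := by
    simp [map_star, star_eq_conjTranspose, Matrix.mul_assoc]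

universe u

/-- The induction must range over all compact parameter spaces: the step replaces Ω by the space of
pairs of a point and a reducing compression. With σ handling the compressions and θ the residue (1 −
σ)K, the map σ + θ(1 − σ) has error b − σb − θ(b − σb). -/
theorem exists_finiteRank_approx {A : Type*} [NonUnitalCStarAlgebra A] (n : ℕ) :
    ∀ {Ω : Type u} [TopologicalSpace Ω] [CompactSpace Ω]
      (ρ : Ω → A →⋆ₙₐ[ℂ] Matrix (Fin n) (Fin n) ℂ) (_ : ∀ a, Continuous fun ω => ρ ω a)
      {K : Set A} (_ : IsCompact K) {ε : ℝ} (_ : 0 < ε),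
      ∃ θ : A →L[ℂ] A, FiniteDimensional ℂ (LinearMap.range θ.toLinearMap) ∧
        ∀ b ∈ K, ∀ ω, ‖ρ ω (b - θ b)‖ ≤ ε := by
  induction n with
  | zero =>
    intro Ω _ _ ρ _ K _ ε hε
    refine ⟨0, ?_, fun b _ ω => ?_⟩
    · rw [ContinuousLinearMap.toLinearMap_zero, LinearMap.range_zero]
      infer_instance
    · rw [Subsingleton.elim (ρ ω (b - (0 : A →L[ℂ] A) b)) 0, norm_zero]
      exact hε.le
  | succ k ih =>
    intro Ω _ _ ρ hρ K hK ε hε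
    -- Partial isometries, rather than isometries, let one matrix shape serve reducing subspaces of
    -- every dimension at most k, so that a single closed bounded condition describes them all.
    let S : Set (Ω × Matrix (Fin (k + 1)) (Fin k) ℂ) := {p | p.2 * p.2ᴴ * p.2 = p.2 ∧
      ∀ b, p.2 * p.2ᴴ * ρ p.1 b = ρ p.1 b * (p.2 * p.2ᴴ)}
    have hS : IsCompact S := by
      have : ProperSpace (Matrix (Fin (k + 1)) (Fin k) ℂ) := FiniteDimensional.proper ℂ _
      refine (isCompact_univ.prod (isCompact_closedBall (0 : Matrix (Fin (k + 1)) (Fin k) ℂ)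
        1)).of_isClosed_subset ?_ ?_
      · have hcP : Continuous fun p : Ω × Matrix (Fin (k + 1)) (Fin k) ℂ => p.2 * p.2ᴴ :=
          continuous_snd.matrix_mul continuous_snd.matrix_conjTranspose
        simp only [S, Set.ofPred_and, Set.ofPred_forall]
        refine (isClosed_eq (hcP.matrix_mul continuous_snd) continuous_snd).inter
          (isClosed_iInter fun b => ?_)
        have hb : Continuous fun p : Ω × Matrix (Fin (k + 1)) (Fin k) ℂ => ρ p.1 b :=
          (hρ b).comp continuous_fst
        exact isClosed_eq (hcP.matrix_mul hb) (hb.matrix_mul hcP)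
      · intro p hp
        exact ⟨trivial, by simpa using norm_le_one_of_partialIsometry hp.1⟩
    have : CompactSpace S := isCompact_iff_compactSpace.1 hS
    obtain ⟨σ, hσ, hσK⟩ := ih (fun p : S => compression (ρ p.1.1) p.1.2 p.2.1 p.2.2)
      (fun a => by
        have h1 : Continuous fun p : S => p.1.2 := continuous_snd.comp continuous_subtype_val
        have h2 : Continuous fun p : S => ρ p.1.1 a :=
          (hρ a).comp (continuous_fst.comp continuous_subtype_val)
        exact (h1.matrix_conjTranspose.matrix_mul h2).matrix_mul h1)
      -- A reducible fibre splits into two compressions, giving 2 · ε/18 = ε/9; the gluing step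
      -- multiplies this by 9.
      hK (ε := ε / 18) (by positivity)
    obtain ⟨θ, hθ, hθK⟩ := exists_finiteRank_approx_of_small (ε := ε / 9) (Nat.succ_ne_zero k) hρ
      (hK.image (ContinuousLinearMap.id ℂ A - σ).continuous) (by positivity) (by
        rintro _ ⟨b, hb, rfl⟩ ω hω
        have := norm_le_of_compressions (ρ ω) hω (ε := ε / 18) (by positivity) (b - σ b)
          fun V hV hc => hσK b hb ⟨(ω, V), hV, hc⟩
        refine le_trans this (by linarith))
    refine ⟨σ + θ.comp (ContinuousLinearMap.id ℂ A - σ), ?_, fun b hb ω => ?_⟩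
    · refine Submodule.finiteDimensional_of_le
        (S₂ := LinearMap.range σ.toLinearMap ⊔ LinearMap.range θ.toLinearMap) ?_
      rintro _ ⟨a, rfl⟩
      exact Submodule.add_mem_sup ⟨a, rfl⟩ ⟨_, rfl⟩
    · have h := hθK _ ⟨b, hb, rfl⟩ ω
      have h2 : b - (σ + θ.comp (ContinuousLinearMap.id ℂ A - σ)) b =
          (ContinuousLinearMap.id ℂ A - σ) b - θ ((ContinuousLinearMap.id ℂ A - σ) b) := by
        simp [sub_sub]
      rw [h2]
      exact h.trans (by linarith)

end Induction

end SchurMult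

/-! ### Norms of operator matrices over a C*-algebra. -/

namespace SchurMult

section BlockOp

variable {E : Type*} [NormedAddCommGroup E] [InnerProductSpace ℂ E]

/-- The operator on `E^ι` given by a matrix of operators on `E`. -/
noncomputable def blockOp {ι : Type*} [Fintype ι] (x : ι → ι → (E →L[ℂ] E)) :
    PiLp 2 (fun _ : ι => E) →L[ℂ] PiLp 2 (fun _ : ι => E) :=
  ((PiLp.continuousLinearEquiv 2 ℂ (fun _ : ι => E)).symm :
      (ι → E) →L[ℂ] PiLp 2 (fun _ : ι => E)) ∘L
    ContinuousLinearMap.pi fun i => ∑ j, x i j ∘L PiLp.proj 2 (fun _ : ι => E) j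

variable {ι : Type*} [Fintype ι]

theorem blockOp_apply (x : ι → ι → (E →L[ℂ] E)) (ξ : PiLp 2 (fun _ : ι => E)) (i : ι) :
    blockOp x ξ i = ∑ j, x i j (ξ j) := by
  simp [blockOp]

theorem inner_blockOp (x : ι → ι → (E →L[ℂ] E)) (η ξ : PiLp 2 (fun _ : ι => E)) :
    inner ℂ η (blockOp x ξ) = ∑ i, ∑ j, inner ℂ (η i) (x i j (ξ j)) := by
  simp only [PiLp.inner_apply, blockOp_apply, inner_sum]

theorem norm_le_of_forall_norm_inner_le {E F : Type*} [NormedAddCommGroup E]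
    [InnerProductSpace ℂ E] [NormedAddCommGroup F] [InnerProductSpace ℂ F] (T : E →L[ℂ] F) {C : ℝ}
    (hC : 0 ≤ C) (h : ∀ η ξ, ‖inner ℂ η (T ξ)‖ ≤ C * ‖η‖ * ‖ξ‖) : ‖T‖ ≤ C := by
  refine T.opNorm_le_bound hC fun ξ => ?_
  have h1 := h (T ξ) ξ
  rw [inner_self_eq_norm_sq_to_K, norm_pow] at h1
  simp only [RCLike.norm_ofReal, abs_norm] at h1
  by_cases h0 : ‖T ξ‖ = 0
  · rw [h0]; positivity
  · have hpos : 0 < ‖T ξ‖ := lt_of_le_of_ne (norm_nonneg _) (Ne.symm h0)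
    nlinarith

theorem norm_inner_blockOp_le (x : ι → ι → (E →L[ℂ] E)) (η ξ : PiLp 2 (fun _ : ι => E)) :
    ‖inner ℂ η (blockOp x ξ)‖ ≤ ‖blockOp x‖ * ‖η‖ * ‖ξ‖ := by
  calc _ ≤ ‖η‖ * ‖blockOp x ξ‖ := norm_inner_le_norm _ _
    _ ≤ ‖η‖ * (‖blockOp x‖ * ‖ξ‖) := by gcongr; exact (blockOp x).le_opNorm ξ
    _ = _ := by ring

theorem blockOp_zero : blockOp (fun _ _ : ι => (0 : E →L[ℂ] E)) = 0 := by
  ext ξ i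
  simp [blockOp_apply]

theorem blockOp_smul (c : ℂ) (x : ι → ι → (E →L[ℂ] E)) :
    blockOp (fun i j => c • x i j) = c • blockOp x := by
  ext ξ i
  simp [blockOp_apply, Finset.smul_sum]

theorem blockOp_add (x y : ι → ι → (E →L[ℂ] E)) :
    blockOp (fun i j => x i j + y i j) = blockOp x + blockOp y := by
  ext ξ i
  simp [blockOp_apply, Finset.sum_add_distrib]

theorem blockOp_mul (x y : ι → ι → (E →L[ℂ] E)) :
    blockOp (fun i j => ∑ k, x i k * y k j) = blockOp x * blockOp y := by
  ext ξ i
  simp only [blockOp_apply, mul_apply_eq_comp, _root_.sum_apply, map_sum]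
  rw [Finset.sum_comm]

theorem blockOp_star [CompleteSpace E] (x : ι → ι → (E →L[ℂ] E)) :
    blockOp (fun i j => star (x j i)) = star (blockOp x) := by
  rw [ContinuousLinearMap.star_eq_adjoint, ContinuousLinearMap.eq_adjoint_iff]
  intro ξ η
  rw [← inner_conj_symm, inner_blockOp, inner_blockOp, map_sum]
  simp only [map_sum, inner_conj_symm]
  rw [Finset.sum_comm]
  refine Finset.sum_congr rfl fun i _ => Finset.sum_congr rfl fun j _ => ?_
  rw [ContinuousLinearMap.star_eq_adjoint,
    ContinuousLinearMap.adjoint_inner_left]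

/-- The amplification of a representation to matrices. -/
noncomputable def amplification [CompleteSpace E] {A : Type*} [NonUnitalCStarAlgebra A]
    (π : A →⋆ₙₐ[ℂ] (E →L[ℂ] E)) (ι : Type*) [Fintype ι] :
    CStarMatrix ι ι A →⋆ₙₐ[ℂ] (PiLp 2 (fun _ : ι => E) →L[ℂ] PiLp 2 (fun _ : ι => E)) where
  toFun x := blockOp fun i j => π (CStarMatrix.ofMatrix.symm x i j)
  map_smul' c x := by
    rw [MonoidHom.id_apply, ← blockOp_smul]
    congr 1
    funext i j
    exact map_smul π c _
  map_zero' := by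
    rw [← blockOp_zero]
    congr 1
    funext i j
    exact map_zero π
  map_add' x y := by
    rw [← blockOp_add]
    congr 1
    funext i j
    exact map_add π _ _
  map_mul' x y := by
    rw [← blockOp_mul]
    congr 1
    funext i j
    refine (map_sum π _ _).trans (Finset.sum_congr rfl fun k _ => ?_)
    exact map_mul π _ _
  map_star' x := by
    rw [← blockOp_star]
    congr 1
    funext i j
    exact map_star π _

/-- The norm of a C*-algebra is the supremum over any jointly injective family of
representations. -/
theorem norm_le_of_forall_norm_map_le {D I : Type*} [NonUnitalCStarAlgebra D] {B : I → Type*}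
    [∀ i, NonUnitalCStarAlgebra (B i)] (π : ∀ i, D →⋆ₙₐ[ℂ] B i)
    (hinj : ∀ d, (∀ i, π i d = 0) → d = 0) {d : D} {C : ℝ} (hC : 0 ≤ C)
    (h : ∀ i, ‖π i d‖ ≤ C) : ‖d‖ ≤ C := by
  let Φ : D →⋆ₙₐ[ℂ] lp B ⊤ :=
    { toFun := fun d => ⟨fun i => π i d, memℓp_infty ⟨‖d‖, by
        rintro _ ⟨i, rfl⟩
        exact norm_map_le (π i) d⟩⟩
      map_smul' := fun c x => by ext i; simp
      map_zero' := by ext i; simp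
      map_add' := fun x y => by ext i; exact map_add (π i) x y
      map_mul' := fun x y => by ext i; simp
      map_star' := fun x => by ext i; simp [map_star] }
  have hΦ : Function.Injective Φ := by
    rw [injective_iff_map_eq_zero]
    intro d hd
    refine hinj d fun i => ?_
    exact congrArg (fun f : lp B ⊤ => f i) hd
  rw [← NonUnitalStarAlgHom.norm_map Φ hΦ d]
  exact lp.norm_le_of_forall_le hC h

theorem blockOp_injective [CompleteSpace E] [DecidableEq ι] {x : ι → ι → (E →L[ℂ] E)}
    (h : blockOp x = 0) (i j : ι) : x i j = 0 := by
  ext v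
  have h1 := congrArg (fun T => T (PiLp.single 2 j v) i) h
  simpa [blockOp_apply, Pi.single_apply, apply_ite] using h1

section Compare

variable {A : Type*} [NonUnitalCStarAlgebra A] [CompleteSpace E]
  {π : A →⋆ₙₐ[ℂ] (E →L[ℂ] E)}
  {Ω : Type*} {F : Type*} [NormedAddCommGroup F] [InnerProductSpace ℂ F] [CompleteSpace F]

/-- The amplification of a faithful π is faithful, hence isometric on matrices over `A`, while that
of ρ is contractive. -/
theorem norm_blockOp_map_le (hπ : Function.Injective π) (ρ : A →⋆ₙₐ[ℂ] (F →L[ℂ] F))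
    (x : ι → ι → A) : ‖blockOp fun i j => ρ (x i j)‖ ≤ ‖blockOp fun i j => π (x i j)‖ := by
  classical
  let _ := CStarAlgebra.spectralOrder A
  have := CStarAlgebra.spectralOrderedRing A
  have hinj : Function.Injective (amplification π ι) := by
    rw [injective_iff_map_eq_zero]
    intro d hd
    ext i j
    exact hπ ((blockOp_injective hd i j).trans (map_zero π).symm)
  have h := NonUnitalStarAlgHom.norm_map (amplification π ι) hinj
    (CStarMatrix.ofMatrix (Matrix.of x))
  exact (norm_map_le (amplification ρ ι) (CStarMatrix.ofMatrix (Matrix.of x))).trans h.ge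

/-- The amplifications of a jointly faithful family are jointly faithful, so they compute the
C*-norm of a matrix, which dominates its norm under π. -/
theorem norm_blockOp_le_of_forall (ρ : Ω → A →⋆ₙₐ[ℂ] (F →L[ℂ] F))
    (hρ : ∀ a, (∀ ω, ρ ω a = 0) → a = 0) (x : ι → ι → A) {C : ℝ} (hC : 0 ≤ C)
    (h : ∀ ω, ‖blockOp fun i j => ρ ω (x i j)‖ ≤ C) : ‖blockOp fun i j => π (x i j)‖ ≤ C := by
  classical
  let _ := CStarAlgebra.spectralOrder A
  have := CStarAlgebra.spectralOrderedRing A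
  have h1 := norm_le_of_forall_norm_map_le (D := CStarMatrix ι ι A)
    (fun ω => amplification (ρ ω) ι) (fun d hd => by
      ext i j
      exact hρ _ fun ω => blockOp_injective (hd ω) i j)
    (d := CStarMatrix.ofMatrix (Matrix.of x)) hC h
  exact (norm_map_le (amplification π ι) (CStarMatrix.ofMatrix (Matrix.of x))).trans h1

end Compare

end BlockOp

end SchurMult

/-! ### Smith's lemma for entrywise maps. -/

namespace SchurMult

section Smith

variable {ι κ : Type*} [Fintype ι] [Fintype κ]

open ComplexConjugate

/-- Normalises a vector of ℂ^ι ⊗ ℂ^κ for each fixed κ-index. The unit parts u will compress the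
amplification index ι; the lengths r form a vector of the same norm indexed by κ alone. -/
theorem exists_polar (c : ι × κ → ℂ) : ∃ (r : κ → ℝ) (u : ι × κ → ℂ),
    (∀ a, c a = r a.2 * u a) ∧ (∀ q, ∑ i, ‖u (i, q)‖ ^ 2 ≤ 1) ∧
      ∑ q, r q ^ 2 = ∑ a, ‖c a‖ ^ 2 := by
  let r : κ → ℝ := fun q => Real.sqrt (∑ i, ‖c (i, q)‖ ^ 2)
  have hr : ∀ q, r q ^ 2 = ∑ i, ‖c (i, q)‖ ^ 2 := fun q =>
    Real.sq_sqrt (Finset.sum_nonneg fun _ _ => by positivity)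
  -- Where `r` vanishes the quotient is 0 by convention, which is why the columns of u have norm at
  -- most 1 rather than equal to 1.
  refine ⟨r, fun a => c a / r a.2, fun a => ?_, fun q => ?_, ?_⟩
  · by_cases h : r a.2 = 0
    · have h1 : ∑ i, ‖c (i, a.2)‖ ^ 2 = 0 := by rw [← hr, h]; simp
      have h2 := (Finset.sum_eq_zero_iff_of_nonneg (fun _ _ => by positivity)).1 h1 a.1
        (Finset.mem_univ _)
      rw [h, Complex.ofReal_zero, zero_mul]
      simpa using h2
    · have : (r a.2 : ℂ) ≠ 0 := by exact_mod_cast h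
      field_simp
  · simp only [norm_div, div_pow, ← Finset.sum_div, ← hr, Complex.norm_real, Real.norm_eq_abs,
      sq_abs]
    exact div_self_le_one _
  · rw [Fintype.sum_prod_type_right]
    exact Finset.sum_congr rfl fun q _ => hr q

/-- The matrix on the left is W_v* y W_u, where W_u sends ξ to (u_{i,q} ξ_q) and is a contraction.
The κ-indices are untouched, so the compression commutes with maps depending only on them. -/
theorem norm_blockOp_compress_le {E : Type*} [NormedAddCommGroup E] [InnerProductSpace ℂ E]
    (y : ι × κ → ι × κ → (E →L[ℂ] E)) (u v : ι × κ → ℂ)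
    (hu : ∀ q, ∑ i, ‖u (i, q)‖ ^ 2 ≤ 1) (hv : ∀ q, ∑ i, ‖v (i, q)‖ ^ 2 ≤ 1) :
    ‖blockOp fun p q => ∑ i, ∑ j, (conj (v (i, p)) * u (j, q)) • y (i, p) (j, q)‖ ≤
      ‖blockOp y‖ := by
  have hten : ∀ (u : ι × κ → ℂ) (_ : ∀ q, ∑ i, ‖u (i, q)‖ ^ 2 ≤ 1) (ξ : PiLp 2 fun _ : κ => E),
      ‖(WithLp.toLp 2 fun a : ι × κ => u a • ξ a.2 : PiLp 2 fun _ : ι × κ => E)‖ ≤ ‖ξ‖ := by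
    intro u hu ξ
    rw [← sq_le_sq₀ (norm_nonneg _) (norm_nonneg _), PiLp.norm_sq_eq_of_L2, PiLp.norm_sq_eq_of_L2,
      Fintype.sum_prod_type_right]
    refine Finset.sum_le_sum fun q _ => ?_
    simp only [norm_smul, mul_pow, ← Finset.sum_mul]
    exact mul_le_of_le_one_left (by positivity) (hu q)
  refine norm_le_of_forall_norm_inner_le _ (by positivity) fun η ξ => ?_
  have h1 : inner ℂ η ((blockOp fun p q =>
        ∑ i, ∑ j, (conj (v (i, p)) * u (j, q)) • y (i, p) (j, q)) ξ) =
      inner ℂ (WithLp.toLp 2 fun a : ι × κ => v a • η a.2 : PiLp 2 fun _ : ι × κ => E)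
        (blockOp y (WithLp.toLp 2 fun a : ι × κ => u a • ξ a.2)) := by
    rw [inner_blockOp, inner_blockOp, Fintype.sum_prod_type_right]
    refine Finset.sum_congr rfl fun p _ => ?_
    simp only [_root_.sum_apply, inner_sum, Fintype.sum_prod_type_right, inner_smul_left, map_smul,
      inner_smul_right, _root_.smul_apply]
    rw [Finset.sum_comm]
    refine Finset.sum_congr rfl fun i _ => Finset.sum_congr rfl fun q _ =>
      Finset.sum_congr rfl fun j _ => ?_
    ring
  rw [h1]
  refine (norm_inner_blockOp_le _ _ _).trans ?_
  gcongr
  · exact hten v hv η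
  · exact hten u hu ξ

variable {A : Type*} [NonUnitalCStarAlgebra A] {H : Type*} [NormedAddCommGroup H]
  [InnerProductSpace ℂ H] [CompleteSpace H] {π : A →⋆ₙₐ[ℂ] (H →L[ℂ] H)}

/-- Entrywise maps, seen through an `n`-dimensional representation: the bound for scalar
amplifications of size one controls those of all sizes. -/
theorem norm_blockOp_entrywise_le (hπ : Function.Injective π) {n : ℕ}
    (ρ : A →⋆ₙₐ[ℂ] (EuclideanSpace ℂ (Fin n) →L[ℂ] EuclideanSpace ℂ (Fin n)))
    (ψ : κ → κ → (A →ₗ[ℂ] A)) {δ : ℝ} (hδ : 0 ≤ δ)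
    (h : ∀ z : κ → κ → A, ‖blockOp fun p q => π (ψ p q (z p q))‖ ≤
      δ * ‖blockOp fun p q => π (z p q)‖) (x : ι × κ → ι × κ → A) :
    ‖blockOp fun a b => ρ (ψ a.2 b.2 (x a b))‖ ≤
      n ^ 2 * δ * ‖blockOp fun a b => π (x a b)‖ := by
  refine norm_le_of_forall_norm_inner_le _ (by positivity) fun η ξ => ?_
  set e := EuclideanSpace.basisFun (Fin n) ℂ with he
  have hcoord : ∀ (ξ : PiLp 2 fun _ : ι × κ => EuclideanSpace ℂ (Fin n)) (k : Fin n),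
      ∑ a, ‖ξ a k‖ ^ 2 ≤ ‖ξ‖ ^ 2 := by
    intro ξ k
    rw [PiLp.norm_sq_eq_of_L2]
    refine Finset.sum_le_sum fun a _ => ?_
    rw [EuclideanSpace.norm_sq_eq]
    exact Finset.single_le_sum (f := fun k => ‖ξ a k‖ ^ 2) (fun _ _ => by positivity)
      (Finset.mem_univ k)
  -- One bound per pair of coordinates of ℂ^n; the n² pairs produce the constant.
  have key : ∀ k l : Fin n, ‖∑ a, ∑ b, conj (η a l) * ξ b k *
      inner ℂ (e l) (ρ (ψ a.2 b.2 (x a b)) (e k))‖ ≤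
        δ * ‖blockOp fun a b => π (x a b)‖ * ‖η‖ * ‖ξ‖ := by
    intro k l
    obtain ⟨r, u, hru, hu, hr⟩ := exists_polar fun a => ξ a k
    obtain ⟨s, v, hsv, hv, hs⟩ := exists_polar fun a => η a l
    let z : κ → κ → A := fun p q => ∑ i, ∑ j, (conj (v (i, p)) * u (j, q)) • x (i, p) (j, q)
    let ξ' : PiLp 2 fun _ : κ => EuclideanSpace ℂ (Fin n) := WithLp.toLp 2 fun q => (r q : ℂ) • e k
    let η' : PiLp 2 fun _ : κ => EuclideanSpace ℂ (Fin n) := WithLp.toLp 2 fun q => (s q : ℂ) • e l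
    have hnorm : ∀ (r : κ → ℝ) (k : Fin n) (ξ : PiLp 2 fun _ : ι × κ => EuclideanSpace ℂ (Fin n))
        (_ : ∑ q, r q ^ 2 = ∑ a, ‖ξ a k‖ ^ 2),
        ‖(WithLp.toLp 2 fun q => (r q : ℂ) • e k :
          PiLp 2 fun _ : κ => EuclideanSpace ℂ (Fin n))‖ ≤ ‖ξ‖ := by
      intro r k ξ hr
      rw [← sq_le_sq₀ (norm_nonneg _) (norm_nonneg _), PiLp.norm_sq_eq_of_L2]
      simp only [norm_smul, e.norm_eq_one, mul_one, Complex.norm_real, Real.norm_eq_abs, sq_abs]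
      rw [hr]
      exact hcoord ξ k
    have hz : ‖blockOp fun p q => π (z p q)‖ ≤ ‖blockOp fun a b => π (x a b)‖ := by
      have := norm_blockOp_compress_le (fun a b => π (x a b)) u v hu hv
      refine le_of_eq_of_le ?_ this
      congr 2
      funext p q
      simp [z, map_sum]
    have heq : ∑ a, ∑ b, conj (η a l) * ξ b k * inner ℂ (e l) (ρ (ψ a.2 b.2 (x a b)) (e k)) =
        inner ℂ η' (blockOp (fun p q => ρ (ψ p q (z p q))) ξ') := by
      rw [inner_blockOp, Fintype.sum_prod_type_right]
      refine Finset.sum_congr rfl fun p _ => ?_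
      simp only [z, ξ', η', map_sum, map_smul, Fintype.sum_prod_type_right, inner_smul_left,
        _root_.sum_apply, inner_sum, _root_.smul_apply, inner_smul_right]
      rw [Finset.sum_comm]
      refine Finset.sum_congr rfl fun q _ => ?_
      rw [Finset.mul_sum]
      refine Finset.sum_congr rfl fun i _ => ?_
      rw [Finset.mul_sum]
      refine Finset.sum_congr rfl fun j _ => ?_
      have h1 := hsv (i, p)
      have h2 := hru (j, q)
      simp only at h1 h2
      rw [h1, h2, map_mul, Complex.conj_ofReal]
      ring
    rw [heq]
    calc _ ≤ ‖blockOp fun p q => ρ (ψ p q (z p q))‖ * ‖η'‖ * ‖ξ'‖ := norm_inner_blockOp_le _ _ _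
      _ ≤ ‖blockOp fun p q => π (ψ p q (z p q))‖ * ‖η‖ * ‖ξ‖ := by
        gcongr
        · exact norm_blockOp_map_le hπ ρ fun p q => ψ p q (z p q)
        · exact hnorm s l η hs
        · exact hnorm r k ξ hr
      _ ≤ (δ * ‖blockOp fun p q => π (z p q)‖) * ‖η‖ * ‖ξ‖ := by gcongr; exact h z
      _ ≤ _ := by gcongr
  have hexp : inner ℂ η ((blockOp fun a b => ρ (ψ a.2 b.2 (x a b))) ξ) =
      ∑ k, ∑ l, ∑ a, ∑ b, conj (η a l) * ξ b k *
        inner ℂ (e l) (ρ (ψ a.2 b.2 (x a b)) (e k)) := by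
    rw [inner_blockOp]
    have h1 : ∀ a b, inner ℂ (η a) (ρ (ψ a.2 b.2 (x a b)) (ξ b)) = ∑ k, ∑ l,
        conj (η a l) * ξ b k * inner ℂ (e l) (ρ (ψ a.2 b.2 (x a b)) (e k)) := by
      intro a b
      conv_lhs => rw [← e.sum_repr (ξ b), ← e.sum_repr (η a)]
      simp only [map_sum, map_smul, sum_inner, inner_sum, inner_smul_left, inner_smul_right]
      refine Finset.sum_congr rfl fun k _ => ?_
      rw [Finset.mul_sum]
      refine Finset.sum_congr rfl fun l _ => ?_
      simp only [he, EuclideanSpace.basisFun_repr]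
      ring
    simp only [h1]
    calc _ = ∑ a, ∑ k, ∑ l, ∑ b, conj (η a l) * ξ b k *
          inner ℂ (e l) (ρ (ψ a.2 b.2 (x a b)) (e k)) := by
          refine Finset.sum_congr rfl fun a _ => ?_
          rw [Finset.sum_comm]
          exact Finset.sum_congr rfl fun k _ => Finset.sum_comm
      _ = _ := by
          rw [Finset.sum_comm]
          exact Finset.sum_congr rfl fun k _ => Finset.sum_comm
  rw [hexp]
  calc _ ≤ ∑ k : Fin n, ∑ l : Fin n, δ * ‖blockOp fun a b => π (x a b)‖ * ‖η‖ * ‖ξ‖ :=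
        norm_sum_le_of_le _ fun k _ => norm_sum_le_of_le _ fun l _ => key k l
    _ = _ := by
        simp only [Finset.sum_const, Finset.card_univ, Fintype.card_fin, nsmul_eq_mul]
        ring

end Smith

end SchurMult

/-! ### Truncation to finite corners of operators on ℓ²(ℕ, H). -/

namespace SchurMult

section Truncation

variable {H : Type*} [NormedAddCommGroup H] [InnerProductSpace ℂ H]

theorem inner_single_apply_single (T : Ell2 H →L[ℂ] Ell2 H) (p q : ℕ) (u v : H) :
    inner ℂ (lp.single 2 p u : Ell2 H) (T (lp.single 2 q v)) = inner ℂ u (entry p q T v) := by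
  rw [lp.inner_single_left]
  rfl

theorem inner_matUnit_apply (p q : ℕ) (a : H →L[ℂ] H) (η ξ : Ell2 H) :
    inner ℂ η (matUnit p q a ξ) = inner ℂ (η p) (a (ξ q)) := by
  have : matUnit p q a ξ = lp.single 2 p (a (ξ q)) := rfl
  rw [this, lp.inner_single_right]

theorem norm_sq_sum_single {N : ℕ} (ζ : Fin N → H) :
    ‖∑ q : Fin N, (lp.single 2 (q : ℕ) (ζ q) : Ell2 H)‖ ^ 2 = ∑ q, ‖ζ q‖ ^ 2 := by
  have h1 : inner ℂ (∑ q : Fin N, (lp.single 2 (q : ℕ) (ζ q) : Ell2 H))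
      (∑ q : Fin N, (lp.single 2 (q : ℕ) (ζ q) : Ell2 H)) = ∑ q, inner ℂ (ζ q) (ζ q) := by
    rw [sum_inner]
    refine Finset.sum_congr rfl fun p _ => ?_
    rw [inner_sum, Finset.sum_eq_single p]
    · rw [lp.inner_single_left, lp.single_apply_self]
    · intro q _ hq
      rw [lp.inner_single_left, lp.single_apply_ne _ _ _ (fun h => hq (Fin.ext h.symm)),
        inner_zero_right]
    · simp
  simp only [inner_self_eq_norm_sq_to_K] at h1
  exact_mod_cast h1

theorem sum_norm_sq_le (N : ℕ) (ξ : Ell2 H) : ∑ q : Fin N, ‖ξ q‖ ^ 2 ≤ ‖ξ‖ ^ 2 := by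
  rw [Fin.sum_univ_eq_sum_range (fun q => ‖ξ q‖ ^ 2) N]
  simpa using lp.sum_rpow_le_norm_rpow (p := 2) (by simp) ξ (Finset.range N)

/-- The block of entries is W* x W, with W the inclusion of the first N coordinates in each of the ι
summands. -/
theorem norm_blockOp_entry_le {ι : Type*} [Fintype ι] (N : ℕ)
    (x : ι → ι → (Ell2 H →L[ℂ] Ell2 H)) :
    ‖blockOp fun a b : ι × Fin N => entry a.2 b.2 (x a.1 b.1)‖ ≤ ‖blockOp x‖ := by
  have hW : ∀ ζ : PiLp 2 fun _ : ι × Fin N => H,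
      ‖(WithLp.toLp 2 fun i => ∑ q : Fin N, (lp.single 2 (q : ℕ) (ζ (i, q)) : Ell2 H) :
        PiLp 2 fun _ : ι => Ell2 H)‖ ≤ ‖ζ‖ := by
    intro ζ
    rw [← sq_le_sq₀ (norm_nonneg _) (norm_nonneg _), PiLp.norm_sq_eq_of_L2, PiLp.norm_sq_eq_of_L2,
      Fintype.sum_prod_type]
    exact Finset.sum_le_sum fun i _ => (norm_sq_sum_single fun q => ζ (i, q)).le
  refine norm_le_of_forall_norm_inner_le _ (by positivity) fun η ξ => ?_
  have h : inner ℂ η ((blockOp fun a b : ι × Fin N => entry a.2 b.2 (x a.1 b.1)) ξ) =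
      inner ℂ (WithLp.toLp 2 fun i => ∑ q : Fin N, (lp.single 2 (q : ℕ) (η (i, q)) : Ell2 H) :
        PiLp 2 fun _ : ι => Ell2 H) (blockOp x
        (WithLp.toLp 2 fun i => ∑ q : Fin N, (lp.single 2 (q : ℕ) (ξ (i, q)) : Ell2 H))) := by
    rw [inner_blockOp, inner_blockOp, Fintype.sum_prod_type]
    refine Finset.sum_congr rfl fun i _ => ?_
    simp only [Fintype.sum_prod_type, map_sum, sum_inner, inner_sum, inner_single_apply_single]
    rw [Finset.sum_comm]
    exact Finset.sum_congr rfl fun j _ => Finset.sum_comm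
  rw [h]
  refine (norm_inner_blockOp_le _ _ _).trans ?_
  gcongr
  · exact hW η
  · exact hW ξ

theorem norm_blockOp_sum_matUnit_le {ι : Type*} [Fintype ι] {N : ℕ}
    (z : ι × Fin N → ι × Fin N → (H →L[ℂ] H)) :
    ‖blockOp fun i j : ι => ∑ p : Fin N, ∑ q : Fin N, matUnit p q (z (i, p) (j, q))‖ ≤
      ‖blockOp z‖ := by
  have hR : ∀ ξ : PiLp 2 fun _ : ι => Ell2 H,
      ‖(WithLp.toLp 2 fun a : ι × Fin N => ξ a.1 a.2 : PiLp 2 fun _ : ι × Fin N => H)‖ ≤ ‖ξ‖ := by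
    intro ξ
    rw [← sq_le_sq₀ (norm_nonneg _) (norm_nonneg _), PiLp.norm_sq_eq_of_L2, PiLp.norm_sq_eq_of_L2,
      Fintype.sum_prod_type]
    exact Finset.sum_le_sum fun i _ => sum_norm_sq_le N (ξ i)
  refine norm_le_of_forall_norm_inner_le _ (by positivity) fun η ξ => ?_
  have h : inner ℂ η ((blockOp fun i j : ι =>
        ∑ p : Fin N, ∑ q : Fin N, matUnit p q (z (i, p) (j, q))) ξ) =
      inner ℂ (WithLp.toLp 2 fun a : ι × Fin N => η a.1 a.2 : PiLp 2 fun _ : ι × Fin N => H)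
        (blockOp z (WithLp.toLp 2 fun a : ι × Fin N => ξ a.1 a.2)) := by
    rw [inner_blockOp, inner_blockOp, Fintype.sum_prod_type]
    refine Finset.sum_congr rfl fun i _ => ?_
    simp only [Fintype.sum_prod_type, _root_.sum_apply, inner_sum, inner_matUnit_apply]
    rw [Finset.sum_comm]
  rw [h]
  refine (norm_inner_blockOp_le _ _ _).trans ?_
  gcongr
  · exact hR η
  · exact hR ξ

theorem norm_entry_matrix_le {N : ℕ} (T : Ell2 H →L[ℂ] Ell2 H) :
    ‖blockOp fun p q : Fin N => entry p q T‖ ≤ ‖T‖ := by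
  refine norm_le_of_forall_norm_inner_le _ (by positivity) fun η ξ => ?_
  have hW : ∀ ζ : PiLp 2 fun _ : Fin N => H,
      ‖∑ q : Fin N, (lp.single 2 (q : ℕ) (ζ q) : Ell2 H)‖ ≤ ‖ζ‖ := by
    intro ζ
    rw [← sq_le_sq₀ (norm_nonneg _) (norm_nonneg _), norm_sq_sum_single, PiLp.norm_sq_eq_of_L2]
  have h : inner ℂ η ((blockOp fun p q : Fin N => entry p q T) ξ) =
      inner ℂ (∑ q : Fin N, (lp.single 2 (q : ℕ) (η q) : Ell2 H))
        (T (∑ q : Fin N, (lp.single 2 (q : ℕ) (ξ q) : Ell2 H))) := by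
    simp only [inner_blockOp, map_sum, sum_inner, inner_sum, inner_single_apply_single]
    exact Finset.sum_comm
  rw [h]
  calc _ ≤ _ * _ := norm_inner_le_norm _ _
    _ ≤ ‖η‖ * (‖T‖ * ‖ξ‖) := by
      gcongr
      · exact hW η
      · exact (T.le_opNorm _).trans (by gcongr; exact hW ξ)
    _ = _ := by ring

theorem norm_sum_matUnit_le {N : ℕ} (z : Fin N → Fin N → (H →L[ℂ] H)) :
    ‖∑ p : Fin N, ∑ q : Fin N, matUnit p q (z p q)‖ ≤ ‖blockOp z‖ := by
  refine norm_le_of_forall_norm_inner_le _ (by positivity) fun η ξ => ?_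
  have hR : ∀ ξ : Ell2 H,
      ‖(WithLp.toLp 2 fun q : Fin N => ξ q : PiLp 2 fun _ : Fin N => H)‖ ≤ ‖ξ‖ := by
    intro ξ
    rw [← sq_le_sq₀ (norm_nonneg _) (norm_nonneg _), PiLp.norm_sq_eq_of_L2]
    exact sum_norm_sq_le N ξ
  have h : inner ℂ η ((∑ p : Fin N, ∑ q : Fin N, matUnit p q (z p q)) ξ) =
      inner ℂ (WithLp.toLp 2 fun q : Fin N => η q : PiLp 2 fun _ : Fin N => H)
        (blockOp z (WithLp.toLp 2 fun q : Fin N => ξ q)) := by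
    simp only [inner_blockOp, _root_.sum_apply, inner_sum, inner_matUnit_apply]
  rw [h]
  refine (norm_inner_blockOp_le _ _ _).trans ?_
  gcongr
  · exact hR η
  · exact hR ξ

theorem norm_matUnit_le (p q : ℕ) (a : H →L[ℂ] H) : ‖matUnit p q a‖ ≤ ‖a‖ := by
  refine ContinuousLinearMap.opNorm_le_bound _ (norm_nonneg _) fun ξ => ?_
  have : matUnit p q a ξ = lp.single 2 p (a (ξ q)) := rfl
  rw [this, lp.norm_single (by norm_num)]
  exact (a.le_opNorm _).trans (by gcongr; exact lp.norm_apply_le_norm (by norm_num) ξ q)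

/-- The linear map `a ↦ e_{p,q} ⊗ a`. -/
noncomputable def matUnitLinear (p q : ℕ) : (H →L[ℂ] H) →ₗ[ℂ] (Ell2 H →L[ℂ] Ell2 H) where
  toFun := matUnit p q
  map_add' a b := by
    ext ξ : 1
    exact ((lp.singleContinuousLinearMap ℂ (fun _ : ℕ => H) 2 p).map_add _ _)
  map_smul' c a := by
    ext ξ : 1
    exact ((lp.singleContinuousLinearMap ℂ (fun _ : ℕ => H) 2 p).map_smul c _)

/-- The upper left `N × N` corner. -/
noncomputable def truncation (N : ℕ) : (Ell2 H →L[ℂ] Ell2 H) →ₗ[ℂ] (Ell2 H →L[ℂ] Ell2 H) :=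
  ∑ p : Fin N, ∑ q : Fin N, matUnitLinear p q ∘ₗ entry p q

theorem truncation_apply (N : ℕ) (T : Ell2 H →L[ℂ] Ell2 H) :
    truncation N T = ∑ p : Fin N, ∑ q : Fin N, matUnit p q (entry p q T) := by
  simp [truncation, matUnitLinear]

theorem norm_truncation_le (N : ℕ) (T : Ell2 H →L[ℂ] Ell2 H) : ‖truncation N T‖ ≤ ‖T‖ := by
  rw [truncation_apply]
  exact (norm_sum_matUnit_le _).trans (norm_entry_matrix_le T)

theorem truncation_matUnit {N p q : ℕ} (hp : p < N) (hq : q < N) (a : H →L[ℂ] H) :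
    truncation N (matUnit p q a) = matUnit p q a := by
  have h0 : ∀ p q : ℕ, matUnit p q (0 : H →L[ℂ] H) = 0 := fun p q => map_zero (matUnitLinear p q)
  rw [truncation_apply, Finset.sum_eq_single ⟨p, hp⟩, Finset.sum_eq_single ⟨q, hq⟩]
  · simp [entry_matUnit]
  · intro r _ hr
    rw [entry_matUnit, if_neg (fun h => hr (Fin.ext h.2)), h0]
  · simp
  · intro r _ hr
    refine Finset.sum_eq_zero fun s _ => ?_
    rw [entry_matUnit, if_neg (fun h => hr (Fin.ext h.1)), h0]
  · simp

/-- Equicontinuity of the truncations. It passes convergence from the span of elementary tensors to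
its closure, and makes it uniform on compact sets. -/
theorem norm_truncation_sub_le_add (N : ℕ) (S T : Ell2 H →L[ℂ] Ell2 H) :
    ‖truncation N S - S‖ ≤ ‖truncation N T - T‖ + 2 * ‖S - T‖ := by
  have h : truncation N S - S = (truncation N T - T) + (truncation N (S - T) - (S - T)) := by
    rw [map_sub]; abel
  rw [h]
  have h1 := norm_add_le (E := Ell2 H →L[ℂ] Ell2 H) (truncation N T - T)
    (truncation N (S - T) - (S - T))
  have h2 := norm_sub_le (E := Ell2 H →L[ℂ] Ell2 H) (truncation N (S - T)) (S - T)
  have h3 := norm_truncation_le N (S - T)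
  linarith

variable {V : Submodule ℂ (H →L[ℂ] H)}

theorem exists_norm_truncation_sub_le {T : Ell2 H →L[ℂ] Ell2 H} (hT : T ∈ compactTensor V)
    {ε : ℝ} (hε : 0 < ε) : ∃ N₀, ∀ N ≥ N₀, ‖truncation N T - T‖ ≤ ε := by
  have hspan : ∀ T ∈ Submodule.span ℂ {T | ∃ (m n : ℕ) (a : H →L[ℂ] H), a ∈ V ∧
      T = matUnit m n a}, ∃ N₀, ∀ N ≥ N₀, truncation N T = T := by
    intro T hT
    induction hT using Submodule.span_induction with
    | mem T hT =>
      obtain ⟨p, q, a, -, rfl⟩ := hT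
      exact ⟨max p q + 1, fun N hN => truncation_matUnit (by omega) (by omega) a⟩
    | zero => exact ⟨0, fun N _ => map_zero _⟩
    | add S T _ _ hS hT =>
      obtain ⟨m, hm⟩ := hS
      obtain ⟨n, hn⟩ := hT
      exact ⟨max m n, fun N hN => by rw [map_add, hm N (by omega), hn N (by omega)]⟩
    | smul c T _ hT =>
      obtain ⟨n, hn⟩ := hT
      exact ⟨n, fun N hN => by rw [map_smul, hn N hN]⟩
  have hT' : T ∈ closure ((Submodule.span ℂ {T | ∃ (m n : ℕ) (a : H →L[ℂ] H), a ∈ V ∧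
      T = matUnit m n a} : Submodule ℂ (Ell2 H →L[ℂ] Ell2 H)) :
        Set (Ell2 H →L[ℂ] Ell2 H)) := hT
  obtain ⟨T', hT', hd⟩ := (Metric.mem_closure_iff (α := Ell2 H →L[ℂ] Ell2 H)).1 hT'
    (ε / 2) (by positivity)
  obtain ⟨N₀, hN₀⟩ := hspan T' hT'
  refine ⟨N₀, fun N hN => ?_⟩
  have hd : ‖T - T'‖ < ε / 2 := lt_of_eq_of_lt (dist_eq_norm T T').symm hd
  have h := norm_truncation_sub_le_add N T T'
  have h0 : ‖truncation N T' - T'‖ = 0 := by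
    rw [hN₀ N hN, sub_self]
    exact norm_zero (E := Ell2 H →L[ℂ] Ell2 H)
  linarith

theorem exists_forall_norm_truncation_sub_le {K : Set (compactTensor V)} (hK : IsCompact K)
    {ε : ℝ} (hε : 0 < ε) : ∃ N₀, ∀ N ≥ N₀, ∀ T ∈ K,
      ‖truncation N (T : Ell2 H →L[ℂ] Ell2 H) - T‖ ≤ ε := by
  refine hK.induction_on (p := fun K => ∃ N₀, ∀ N ≥ N₀, ∀ T ∈ K,
      ‖truncation N (T : Ell2 H →L[ℂ] Ell2 H) - T‖ ≤ ε) ?_ ?_ ?_ ?_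
  · exact ⟨0, by simp⟩
  · rintro s t hst ⟨N₀, h⟩
    exact ⟨N₀, fun N hN T hT => h N hN T (hst hT)⟩
  · rintro s t ⟨m, hm⟩ ⟨n, hn⟩
    refine ⟨max m n, fun N hN T hT => ?_⟩
    rcases hT with hT | hT
    · exact hm N (by omega) T hT
    · exact hn N (by omega) T hT
  · intro T _
    obtain ⟨N₀, h⟩ := exists_norm_truncation_sub_le T.2 (half_pos hε)
    have hopen : IsOpen {T' : compactTensor V | ‖(T' : Ell2 H →L[ℂ] Ell2 H) - T‖ < ε / 4} :=
      by
      have h1 : Continuous fun T' : compactTensor V => (T' : Ell2 H →L[ℂ] Ell2 H) - T :=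
        continuous_subtype_val.sub continuous_const
      exact isOpen_lt ((continuous_norm (E := Ell2 H →L[ℂ] Ell2 H)).comp h1) continuous_const
    refine ⟨_, mem_nhdsWithin_of_mem_nhds (hopen.mem_nhds (by
      change ‖(T : Ell2 H →L[ℂ] Ell2 H) - T‖ < ε / 4
      rw [sub_self]
      exact (norm_zero (E := Ell2 H →L[ℂ] Ell2 H)).trans_lt (by positivity))),
      N₀, fun N hN T' hT' => ?_⟩
    have hd : ‖(T' : Ell2 H →L[ℂ] Ell2 H) - T‖ < ε / 4 := hT'
    have h1 := norm_truncation_sub_le_add N (T' : Ell2 H →L[ℂ] Ell2 H) T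
    have h2 := h N hN
    linarith

theorem matUnit_mem_compactTensor (p q : ℕ) {a : H →L[ℂ] H} (ha : a ∈ V) :
    matUnit p q a ∈ compactTensor V :=
  Submodule.le_topologicalClosure _ (Submodule.subset_span ⟨p, q, a, ha, rfl⟩)

theorem norm_blockOp_le_sum {ι : Type*} [Fintype ι] {E : Type*} [NormedAddCommGroup E]
    [InnerProductSpace ℂ E] (x : ι → ι → (E →L[ℂ] E)) :
    ‖blockOp x‖ ≤ ∑ i, ∑ j, ‖x i j‖ := by
  refine norm_le_of_forall_norm_inner_le _ (by positivity) fun η ξ => ?_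
  rw [inner_blockOp, Finset.sum_mul, Finset.sum_mul]
  refine (norm_sum_le _ _).trans (Finset.sum_le_sum fun i _ => ?_)
  rw [Finset.sum_mul, Finset.sum_mul]
  refine (norm_sum_le _ _).trans (Finset.sum_le_sum fun j _ => ?_)
  calc ‖inner ℂ (η i) (x i j (ξ j))‖ ≤ ‖η i‖ * (‖x i j‖ * ‖ξ j‖) :=
        (norm_inner_le_norm _ _).trans (by gcongr; exact (x i j).le_opNorm _)
    _ ≤ ‖η‖ * (‖x i j‖ * ‖ξ‖) := by
        gcongr
        · exact PiLp.norm_apply_le η i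
        · exact PiLp.norm_apply_le ξ j
    _ = _ := by ring

/-- A matrix has finitely many entries, so one N truncates all of them accurately; norms of
amplified matrices can be tested on finite corners. -/
theorem norm_blockOp_le_of_forall_truncation {ι : Type*} [Fintype ι] (x : ι → ι → compactTensor V)
    {C : ℝ} (h : ∀ N, ‖blockOp fun i j => truncation N (x i j : Ell2 H →L[ℂ] Ell2 H)‖ ≤ C) :
    ‖blockOp fun i j => (x i j : Ell2 H →L[ℂ] Ell2 H)‖ ≤ C := by
  refine le_of_forall_pos_le_add fun ε hε => ?_
  have hc : 0 < ε / (Fintype.card ι * Fintype.card ι + 1) := by positivity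
  choose N₀ hN₀ using fun i j => exists_norm_truncation_sub_le (x i j).2 hc
  -- The sum is used only as a common upper bound of the thresholds.
  let N := ∑ i, ∑ j, N₀ i j
  have hN : ∀ i j, N₀ i j ≤ N := fun i j =>
    (Finset.single_le_sum (f := fun j => N₀ i j) (fun _ _ => Nat.zero_le _)
      (Finset.mem_univ j)).trans
      (Finset.single_le_sum (f := fun i => ∑ j, N₀ i j) (fun _ _ => Nat.zero_le _)
        (Finset.mem_univ i))
  let d : ι → ι → (Ell2 H →L[ℂ] Ell2 H) := fun i j =>
    x i j - truncation N (x i j : Ell2 H →L[ℂ] Ell2 H)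
  have hd : ‖blockOp d‖ ≤ ε := by
    refine (norm_blockOp_le_sum d).trans ?_
    calc ∑ i, ∑ j, ‖d i j‖ ≤ ∑ _i : ι, ∑ _j : ι, ε / (Fintype.card ι * Fintype.card ι + 1) := by
          gcongr with i _ j _
          exact (norm_sub_rev (E := Ell2 H →L[ℂ] Ell2 H) _ _).trans_le (hN₀ i j N (hN i j))
      _ = (Fintype.card ι * Fintype.card ι) / (Fintype.card ι * Fintype.card ι + 1) * ε := by
          simp only [Finset.sum_const, Finset.card_univ, nsmul_eq_mul]
          ring
      _ ≤ 1 * ε := by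
          gcongr
          rw [div_le_one (by positivity)]
          linarith
      _ = ε := one_mul ε
  calc ‖blockOp fun i j => (x i j : Ell2 H →L[ℂ] Ell2 H)‖
      = ‖(blockOp fun i j => truncation N (x i j : Ell2 H →L[ℂ] Ell2 H)) + blockOp d‖ := by
        rw [← blockOp_add]
        congr 2
        ext i j : 2
        exact (add_sub_cancel _ _).symm
    _ ≤ C + ε := (ContinuousLinearMap.opNorm_add_le _ _).trans (add_le_add (h N) hd)

end Truncation

end SchurMult

/-! ### Finite-rank corner maps and complete compactness. -/

namespace SchurMult

open scoped Matrix.Norms.L2Operator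

section Corner

variable {H : Type*} [NormedAddCommGroup H] [InnerProductSpace ℂ H]
  {V : Submodule ℂ (H →L[ℂ] H)}

/-- The `(p, q)` entry as a linear map from `K(ℓ²) ⊗ V` to `V`. -/
noncomputable def entryLinear (hV : IsClosed (V : Set (H →L[ℂ] H))) (p q : ℕ) :
    compactTensor V →ₗ[ℂ] V :=
  (entry p q).restrict fun _ hT => entry_mem hV hT p q

theorem continuous_entryLinear (hV : IsClosed (V : Set (H →L[ℂ] H))) (p q : ℕ) :
    Continuous (entryLinear hV p q) :=
  ((continuous_entry p q).comp continuous_subtype_val).subtype_mk _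

/-- The linear map `a ↦ e_{p,q} ⊗ a` from `V` to `K(ℓ²) ⊗ V`. -/
noncomputable def elementaryTensor (p q : ℕ) : V →ₗ[ℂ] compactTensor V :=
  (matUnitLinear p q).restrict fun _ ha => matUnit_mem_compactTensor p q ha

theorem coe_elementaryTensor (p q : ℕ) (a : V) :
    (elementaryTensor p q a : Ell2 H →L[ℂ] Ell2 H) = matUnit p q a := rfl

/-- Apply `θ` to the entries in the upper left `N × N` corner and delete all others. -/
noncomputable def cornerMap (hV : IsClosed (V : Set (H →L[ℂ] H))) (N : ℕ) (θ : V →ₗ[ℂ] V) :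
    compactTensor V →ₗ[ℂ] compactTensor V :=
  ∑ p : Fin N, ∑ q : Fin N, elementaryTensor p q ∘ₗ θ ∘ₗ entryLinear hV p q

theorem coe_cornerMap_apply (hV : IsClosed (V : Set (H →L[ℂ] H))) (N : ℕ) (θ : V →ₗ[ℂ] V)
    (T : compactTensor V) : (cornerMap hV N θ T : Ell2 H →L[ℂ] Ell2 H) =
      ∑ p : Fin N, ∑ q : Fin N, matUnit p q (θ (entryLinear hV p q T) : H →L[ℂ] H) := by
  simp only [cornerMap, LinearMap.sum_apply, Submodule.coe_sum, LinearMap.comp_apply,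
    coe_elementaryTensor]

theorem entry_sum_matUnit {N : ℕ} (z : Fin N → Fin N → (H →L[ℂ] H)) (p q : Fin N) :
    entry p q (∑ r : Fin N, ∑ s : Fin N, matUnit r s (z r s)) = z p q := by
  simp only [map_sum, entry_matUnit]
  rw [Finset.sum_eq_single p, Finset.sum_eq_single q]
  · simp
  · intro s _ hs
    rw [if_neg fun h => hs (Fin.ext h.2.symm)]
  · simp
  · intro r _ hr
    exact Finset.sum_eq_zero fun s _ => if_neg fun h => hr (Fin.ext h.1.symm)
  · simp

theorem entry_sum_matUnit_of_not {N : ℕ} (z : Fin N → Fin N → (H →L[ℂ] H)) {p q : ℕ}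
    (h : ¬(p < N ∧ q < N)) :
    entry p q (∑ r : Fin N, ∑ s : Fin N, matUnit r s (z r s)) = 0 := by
  simp only [map_sum, entry_matUnit]
  refine Finset.sum_eq_zero fun r _ => Finset.sum_eq_zero fun s _ => if_neg fun h' => h ?_
  rw [h'.1, h'.2]
  exact ⟨r.2, s.2⟩

/-- The error of the approximation acts entry by entry, so Smith's lemma applies to it. In the index
`r = (q, p)` the column comes first, hence `r.2` is the row. -/
theorem isSchurMap_sub_cornerMap_comp {hV : IsClosed (V : Set (H →L[ℂ] H))}
    {φ : ℕ × ℕ → (V →ₗ[ℂ] V)} {S : compactTensor V →ₗ[ℂ] compactTensor V}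
    (hS : IsSchurMap hV φ S) (N : ℕ) (θ : V →ₗ[ℂ] V) :
    IsSchurMap hV (fun r => φ r - if r.2 < N ∧ r.1 < N then θ ∘ₗ φ r else 0)
      (S - cornerMap hV N θ ∘ₗ S) := by
  intro T p q
  have h1 : entryLinear hV p q (S T) = φ (q, p) ⟨entry p q (T : Ell2 H →L[ℂ] Ell2 H),
      entry_mem hV T.2 p q⟩ := Subtype.ext (hS T p q)
  have h2 : entry p q (cornerMap hV N θ (S T) : Ell2 H →L[ℂ] Ell2 H) =
      if p < N ∧ q < N then (θ (entryLinear hV p q (S T)) : H →L[ℂ] H) else 0 := by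
    rw [coe_cornerMap_apply]
    split_ifs with h
    · exact entry_sum_matUnit (fun p q : Fin N => (θ (entryLinear hV p q (S T)) : H →L[ℂ] H))
        ⟨p, h.1⟩ ⟨q, h.2⟩
    · exact entry_sum_matUnit_of_not _ h
  rw [LinearMap.sub_apply, Submodule.coe_sub, map_sub, LinearMap.comp_apply, h2, h1, hS T p q]
  change _ = (((φ (q, p) - if p < N ∧ q < N then θ ∘ₗ φ (q, p) else 0 : V →ₗ[ℂ] V)
    ⟨entry p q (T : Ell2 H →L[ℂ] Ell2 H), entry_mem hV T.2 p q⟩ : V) : H →L[ℂ] H)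
  split_ifs with h
  · rfl
  · rw [LinearMap.sub_apply, LinearMap.zero_apply, sub_zero, sub_zero]

theorem finiteDimensional_range_cornerMap (hV : IsClosed (V : Set (H →L[ℂ] H))) (N : ℕ)
    (θ : V →ₗ[ℂ] V) [FiniteDimensional ℂ (LinearMap.range θ)] :
    FiniteDimensional ℂ (LinearMap.range (cornerMap hV N θ)) := by
  have hle : LinearMap.range (cornerMap hV N θ) ≤
      ⨆ r : Fin N × Fin N, (LinearMap.range θ).map (elementaryTensor (r.1 : ℕ) (r.2 : ℕ)) := by
    rintro _ ⟨T, rfl⟩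
    simp only [cornerMap, LinearMap.sum_apply]
    refine Submodule.sum_mem _ fun p _ => Submodule.sum_mem _ fun q _ => ?_
    exact Submodule.mem_iSup_of_mem (p, q)
      (Submodule.mem_map_of_mem (LinearMap.mem_range_self θ _))
  exact Submodule.finiteDimensional_of_le hle

theorem norm_sub_cornerMap_le (hV : IsClosed (V : Set (H →L[ℂ] H))) (N : ℕ) (θ : V →ₗ[ℂ] V)
    (T : compactTensor V) {τ : ℝ} (h : ∀ p q : Fin N,
      ‖entryLinear hV p q T - θ (entryLinear hV p q T)‖ ≤ τ) :
    ‖T - cornerMap hV N θ T‖ ≤ ‖truncation N (T : Ell2 H →L[ℂ] Ell2 H) - T‖ + N * N * τ := by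
  have h1 : ((T - cornerMap hV N θ T : compactTensor V) : Ell2 H →L[ℂ] Ell2 H) =
      -(truncation N (T : Ell2 H →L[ℂ] Ell2 H) - (T : Ell2 H →L[ℂ] Ell2 H)) +
        ∑ p : Fin N, ∑ q : Fin N, (matUnitLinear p q
          ((entryLinear hV p q T - θ (entryLinear hV p q T) : V) : H →L[ℂ] H) :
            Ell2 H →L[ℂ] Ell2 H) := by
    have h2 : ∀ p q : Fin N, (matUnitLinear p q) ((entryLinear hV p q T -
          θ (entryLinear hV p q T) : V) : H →L[ℂ] H) =
        matUnit p q (entry p q (T : Ell2 H →L[ℂ] Ell2 H)) -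
          matUnit p q (θ (entryLinear hV p q T) : H →L[ℂ] H) := fun p q =>
      map_sub (matUnitLinear (p : ℕ) (q : ℕ)) _ _
    simp only [h2, Finset.sum_sub_distrib]
    rw [Submodule.coe_sub, coe_cornerMap_apply, truncation_apply]
    abel
  have h3 : ‖∑ p : Fin N, ∑ q : Fin N, (matUnitLinear p q
      ((entryLinear hV p q T - θ (entryLinear hV p q T) : V) : H →L[ℂ] H) :
        Ell2 H →L[ℂ] Ell2 H)‖ ≤ N * N * τ := by
    calc _ ≤ ∑ _p : Fin N, ∑ _q : Fin N, τ :=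
          norm_sum_le_of_le (E := Ell2 H →L[ℂ] Ell2 H) _ fun p _ =>
            norm_sum_le_of_le (E := Ell2 H →L[ℂ] Ell2 H) _ fun q _ =>
              (norm_matUnit_le _ _ _).trans (h p q)
      _ = _ := by
          simp only [Finset.sum_const, Finset.card_univ, Fintype.card_fin, nsmul_eq_mul]
          ring
  change ‖((T - cornerMap hV N θ T : compactTensor V) : Ell2 H →L[ℂ] Ell2 H)‖ ≤ _
  rw [h1]
  refine (ContinuousLinearMap.opNorm_add_le _ _).trans (add_le_add ?_ h3)
  exact (norm_neg (E := Ell2 H →L[ℂ] Ell2 H) _).le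

end Corner

theorem norm_map_le_of_forall_norm_le_one {E : Type*} [NormedAddCommGroup E] [NormedSpace ℂ E]
    {W : Submodule ℂ E} (f : W →ₗ[ℂ] W) {C : ℝ} (h : ∀ x : W, ‖x‖ ≤ 1 → ‖f x‖ ≤ C) (x : W) :
    ‖f x‖ ≤ C * ‖x‖ := by
  by_cases hx : x = 0
  · simp [hx]
  have hx' : 0 < ‖x‖ := norm_pos_iff.2 hx
  have h1 := h ((‖x‖⁻¹ : ℂ) • x) (by
    rw [norm_smul, norm_inv, Complex.norm_real, norm_norm, inv_mul_cancel₀ hx'.ne'])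
  rw [map_smul, norm_smul, norm_inv, Complex.norm_real, norm_norm] at h1
  rwa [inv_mul_le_iff₀ hx', mul_comm] at h1

section Schur

variable {H : Type*} [NormedAddCommGroup H] [InnerProductSpace ℂ H] [CompleteSpace H]
  {V : Submodule ℂ (H →L[ℂ] H)} {hV : IsClosed (V : Set (H →L[ℂ] H))}
  {A : Type*} [NonUnitalCStarAlgebra A] {π : A →⋆ₙₐ[ℂ] (H →L[ℂ] H)}

/-- Smith's lemma for Schur maps over a subhomogeneous algebra. -/
theorem norm_blockOp_schurMap_le (hπ : Function.Injective π) {n : ℕ} {Ω : Type*}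
    (ρ : Ω → A →⋆ₙₐ[ℂ] (EuclideanSpace ℂ (Fin n) →L[ℂ] EuclideanSpace ℂ (Fin n)))
    (hρ : ∀ a, (∀ ω, ρ ω a = 0) → a = 0) (c : V ≃ₗ[ℂ] A)
    (hc : ∀ v, π (c v) = v) {ψ : ℕ × ℕ → (V →ₗ[ℂ] V)}
    {D : compactTensor V →ₗ[ℂ] compactTensor V} (hD : IsSchurMap hV ψ D) {δ : ℝ} (hδ : 0 ≤ δ)
    (hDδ : ∀ T, ‖D T‖ ≤ δ * ‖T‖) {ι : Type*} [Fintype ι] (x : ι → ι → compactTensor V) :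
    ‖blockOp fun i j => (D (x i j) : Ell2 H →L[ℂ] Ell2 H)‖ ≤
      n ^ 2 * δ * ‖blockOp fun i j => (x i j : Ell2 H →L[ℂ] Ell2 H)‖ := by
  have hcs : ∀ a, ((c.symm a : V) : H →L[ℂ] H) = π a := fun a => by
    rw [← hc, c.apply_symm_apply]
  refine norm_blockOp_le_of_forall_truncation _ fun N => ?_
  let ψ' : Fin N → Fin N → (A →ₗ[ℂ] A) := fun p q =>
    c.toLinearMap ∘ₗ ψ ((q : ℕ), (p : ℕ)) ∘ₗ c.symm.toLinearMap
  let X : ι × Fin N → ι × Fin N → A := fun a b => c (entryLinear hV a.2 b.2 (x a.1 b.1))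
  have hX : (fun a b => π (X a b)) = fun a b : ι × Fin N =>
      entry a.2 b.2 (x a.1 b.1 : Ell2 H →L[ℂ] Ell2 H) := by
    funext a b
    exact hc _
  have hψX : ∀ a b : ι × Fin N, π (ψ' a.2 b.2 (X a b)) =
      entry a.2 b.2 (D (x a.1 b.1) : Ell2 H →L[ℂ] Ell2 H) := by
    intro a b
    rw [hD]
    simp only [ψ', X, LinearMap.comp_apply, LinearEquiv.coe_coe, c.symm_apply_apply, hc]
    rfl
  -- A finite matrix over `A`, extended by zero, is an element of K(ℓ²) ⊗ A, so the bound for `D`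
  -- restricts to finite corners.
  have hfin : ∀ z : Fin N → Fin N → A, ‖blockOp fun p q => π (ψ' p q (z p q))‖ ≤
      δ * ‖blockOp fun p q => π (z p q)‖ := by
    intro z
    let T : compactTensor V := ∑ p : Fin N, ∑ q : Fin N, elementaryTensor p q (c.symm (z p q))
    have hT : (T : Ell2 H →L[ℂ] Ell2 H) =
        ∑ p : Fin N, ∑ q : Fin N, matUnit p q (π (z p q)) := by
      simp only [T, Submodule.coe_sum, coe_elementaryTensor, hcs]
    have hTe : ∀ p q : Fin N, entryLinear hV p q T = c.symm (z p q) := by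
      intro p q
      refine Subtype.ext ?_
      rw [hcs]
      change entry p q (T : Ell2 H →L[ℂ] Ell2 H) = _
      rw [hT]
      exact entry_sum_matUnit (fun p q => π (z p q)) p q
    have hDT : (fun p q => π (ψ' p q (z p q))) = fun p q : Fin N =>
        entry p q (D T : Ell2 H →L[ℂ] Ell2 H) := by
      funext p q
      rw [hD]
      change π (c (ψ (q, p) (c.symm (z p q)))) = (ψ (q, p) (entryLinear hV p q T) : H →L[ℂ] H)
      rw [hc, hTe]
    rw [hDT]
    refine (norm_entry_matrix_le _).trans ((hDδ T).trans ?_)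
    gcongr
    change ‖(T : Ell2 H →L[ℂ] Ell2 H)‖ ≤ _
    rw [hT]
    exact norm_sum_matUnit_le _
  calc ‖blockOp fun i j => truncation N (D (x i j) : Ell2 H →L[ℂ] Ell2 H)‖
      ≤ ‖blockOp fun a b => π (ψ' a.2 b.2 (X a b))‖ := by
        have h : (fun i j => truncation N (D (x i j) : Ell2 H →L[ℂ] Ell2 H)) = fun i j =>
            ∑ p : Fin N, ∑ q : Fin N, matUnit p q (π (ψ' p q (X (i, p) (j, q)))) := by
          funext i j
          rw [truncation_apply]
          exact Finset.sum_congr rfl fun p _ => Finset.sum_congr rfl fun q _ =>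
            congrArg _ (hψX (i, p) (j, q)).symm
        rw [h]
        exact norm_blockOp_sum_matUnit_le fun a b => π (ψ' a.2 b.2 (X a b))
    _ ≤ n ^ 2 * δ * ‖blockOp fun a b => π (X a b)‖ :=
        norm_blockOp_le_of_forall ρ hρ _ (by positivity) fun ω =>
          norm_blockOp_entrywise_le hπ (ρ ω) ψ' hδ hfin X
    _ ≤ _ := by
        have h : ‖blockOp fun a b => π (X a b)‖ ≤
            ‖blockOp fun i j => (x i j : Ell2 H →L[ℂ] Ell2 H)‖ := by
          rw [hX]
          exact norm_blockOp_entry_le N fun i j => (x i j : Ell2 H →L[ℂ] Ell2 H)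
        exact mul_le_mul_of_nonneg_left h (by positivity)

/-- A compact subset of `K(ℓ²) ⊗ A` is almost fixed by a finite rank corner map. -/
theorem exists_forall_norm_sub_cornerMap_le {n : ℕ} {Ω : Type*}
    [TopologicalSpace Ω] [CompactSpace Ω] (ρ : Ω → A →⋆ₙₐ[ℂ] Matrix (Fin n) (Fin n) ℂ)
    (hρc : ∀ a, Continuous fun ω => ρ ω a) (hρ : ∀ a, (∀ ω, ρ ω a = 0) → a = 0)
    (c : V ≃ₗ[ℂ] A) (hc : ∀ v, π (c v) = v) (hcc : Continuous c)
    {K : Set (compactTensor V)} (hK : IsCompact K) {δ : ℝ} (hδ : 0 < δ) :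
    ∃ (N : ℕ) (θ : V →ₗ[ℂ] V), FiniteDimensional ℂ (LinearMap.range θ) ∧
      ∀ T ∈ K, ‖T - cornerMap hV N θ T‖ ≤ 2 * δ := by
  have hcs : ∀ a, ((c.symm a : V) : H →L[ℂ] H) = π a := fun a => by
    rw [← hc, c.apply_symm_apply]
  obtain ⟨N, hN⟩ := exists_forall_norm_truncation_sub_le hK hδ
  let K' : Set A := ⋃ r : Fin N × Fin N, (fun T => c (entryLinear hV r.1 r.2 T)) '' K
  have hK' : IsCompact K' := isCompact_iUnion fun r =>
    hK.image (hcc.comp (continuous_entryLinear hV _ _))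
  -- Errors are added over the N² entries of the corner, so this keeps their total below δ.
  let τ : ℝ := δ / (N * N + 1)
  have hτ : 0 < τ := by positivity
  obtain ⟨θ₀, hfd, hθ₀⟩ := exists_finiteRank_approx n ρ hρc hK' hτ
  let θ : V →ₗ[ℂ] V := c.symm.toLinearMap ∘ₗ θ₀.toLinearMap ∘ₗ c.toLinearMap
  have hfdθ : FiniteDimensional ℂ (LinearMap.range θ) := by
    have hle : LinearMap.range θ ≤ (LinearMap.range θ₀.toLinearMap).map c.symm.toLinearMap := by
      rintro _ ⟨v, rfl⟩
      exact Submodule.mem_map_of_mem (LinearMap.mem_range_self θ₀.toLinearMap (c v))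
    exact Submodule.finiteDimensional_of_le hle
  refine ⟨N, θ, hfdθ, fun T hT => ?_⟩
  have hθ : ∀ p q : Fin N, ‖entryLinear hV p q T - θ (entryLinear hV p q T)‖ ≤ τ := by
    intro p q
    set v := entryLinear hV p q T with hv
    have hmem : c v ∈ K' := Set.mem_iUnion.2 ⟨(p, q), T, hT, rfl⟩
    have h1 : ((v - θ v : V) : H →L[ℂ] H) = π (c v - θ₀ (c v)) := by
      rw [map_sub, hc, ← hcs]
      rfl
    change ‖((v - θ v : V) : H →L[ℂ] H)‖ ≤ τ
    rw [h1]
    exact (norm_map_le π _).trans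
      (norm_le_of_forall_norm_map_le ρ hρ hτ.le fun ω => hθ₀ _ hmem ω)
  have hNτ : N * N * τ ≤ δ := by
    have : N * N * τ = (N * N) / (N * N + 1) * δ := by simp only [τ]; ring
    rw [this]
    refine mul_le_of_le_one_left hδ.le ?_
    rw [div_le_one (by positivity)]
    linarith
  calc ‖T - cornerMap hV N θ T‖ ≤ _ := norm_sub_cornerMap_le hV N θ T hθ
    _ ≤ δ + δ := add_le_add (hN N le_rfl T hT) hNτ
    _ = 2 * δ := (two_mul δ).symm

theorem isCompletelyCompact_of_isCompactOperator (hπ : Function.Injective π) {n : ℕ} {Ω : Type*}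
    [TopologicalSpace Ω] [CompactSpace Ω] (ρ : Ω → A →⋆ₙₐ[ℂ] Matrix (Fin n) (Fin n) ℂ)
    (hρc : ∀ a, Continuous fun ω => ρ ω a) (hρ : ∀ a, (∀ ω, ρ ω a = 0) → a = 0)
    (c : V ≃ₗ[ℂ] A) (hc : ∀ v, π (c v) = v) (hcc : Continuous c)
    {φ : ℕ × ℕ → (V →ₗ[ℂ] V)} {S : compactTensor V →ₗ[ℂ] compactTensor V}
    (hS : IsSchurMap hV φ S) (hcb : IsCompletelyBounded S) (hSc : IsCompactOperator S) :
    IsCompletelyCompact S := by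
  refine ⟨hcb, fun ε hε => ?_⟩
  let ρ' : Ω → A →⋆ₙₐ[ℂ] (EuclideanSpace ℂ (Fin n) →L[ℂ] EuclideanSpace ℂ (Fin n)) := fun ω =>
    ((Matrix.toEuclideanCLM (n := Fin n) (𝕜 := ℂ) : Matrix (Fin n) (Fin n) ℂ →⋆ₙₐ[ℂ]
      (EuclideanSpace ℂ (Fin n) →L[ℂ] EuclideanSpace ℂ (Fin n)))).comp (ρ ω)
  have hρ' : ∀ a, (∀ ω, ρ' ω a = 0) → a = 0 := fun a ha => hρ a fun ω =>
    (map_eq_zero_iff _ (Matrix.toEuclideanCLM (n := Fin n) (𝕜 := ℂ)).injective).1 (ha ω)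
  -- Smith's lemma costs n² and the corner approximation 2δ; this choice makes n² · 2δ strictly less
  -- than ε, also for n = 0.
  let δ : ℝ := ε / (4 * (n ^ 2 + 1))
  have hδ : 0 < δ := by positivity
  obtain ⟨K, hK, hSK⟩ := IsCompactOperator.image_closedBall_subset_compact (𝕜₁ := ℂ) (𝕜₂ := ℂ)
    (M₁ := compactTensor V) (M₂ := compactTensor V) (f := S) hSc 1
  obtain ⟨N, θ, hfd, hN⟩ := exists_forall_norm_sub_cornerMap_le (hV := hV) (π := π) ρ hρc hρ c hc
    hcc hK hδ
  let D : compactTensor V →ₗ[ℂ] compactTensor V := S - cornerMap hV N θ ∘ₗ S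
  have hD1 : ∀ T : compactTensor V, ‖T‖ ≤ 1 → ‖D T‖ ≤ 2 * δ := fun T hT =>
    hN _ (hSK ⟨T, mem_closedBall_zero_iff.2 hT, rfl⟩)
  have hD : ∀ T, ‖D T‖ ≤ 2 * δ * ‖T‖ := norm_map_le_of_forall_norm_le_one D hD1
  refine ⟨LinearMap.range (cornerMap hV N θ), finiteDimensional_range_cornerMap hV N θ,
    fun m x hx => ⟨fun i j => cornerMap hV N θ (S (x i j)), fun i j => ⟨_, rfl⟩, ?_⟩⟩
  have h := norm_blockOp_schurMap_le hπ ρ' hρ' c hc (isSchurMap_sub_cornerMap_comp hS N θ)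
    (by positivity) hD (fun i j => x i j)
  -- `matOp` is definitionally `blockOp` over `Fin m`, and the entries of S^(m)(x) − y are the `D (x
  -- i j)`.
  change ‖blockOp fun i j => (D (x i j) : Ell2 H →L[ℂ] Ell2 H)‖ < ε
  refine h.trans_lt ?_
  change ‖blockOp fun i j => (x i j : Ell2 H →L[ℂ] Ell2 H)‖ ≤ 1 at hx
  calc _ ≤ n ^ 2 * (2 * δ) * 1 := by gcongr
    _ < (n ^ 2 + 1) * (4 * δ) := by nlinarith [sq_nonneg (n : ℝ)]
    _ = ε := by simp only [δ]; field_simp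

end Schur

end SchurMult

/-! ### The theorem. -/

theorem mainTheorem9 {H : Type*} [NormedAddCommGroup H] [InnerProductSpace ℂ H] [CompleteSpace H]
    (A : NonUnitalStarSubalgebra ℂ (H →L[ℂ] H))
    (hA : IsClosed (A.toSubmodule : Set (H →L[ℂ] H)))
    (n : ℕ) {Ω : Type*} [TopologicalSpace Ω] [CompactSpace Ω] [T2Space Ω]
    (B : NonUnitalStarSubalgebra ℂ (Matrix (Fin n) (Fin n) C(Ω, ℂ))) (e : A ≃⋆ₐ[ℂ] B)
    (φ : ℕ × ℕ → (A.toSubmodule →ₗ[ℂ] A.toSubmodule))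
    (hφ : SchurMult.IsCompactSchurMultiplier hA φ) :
    SchurMult.IsCompletelyCompactSchurMultiplier hA φ := by
  obtain ⟨S, hS, hSc⟩ := hφ
  have hAc : IsClosed (A : Set (H →L[ℂ] H)) := hA
  let _ : NonUnitalCStarAlgebra A := NonUnitalStarSubalgebra.nonUnitalCStarAlgebra A
  let π : A →⋆ₙₐ[ℂ] (H →L[ℂ] H) := NonUnitalStarSubalgebraClass.subtype A
  -- Evaluation at the points of Ω. As *-homomorphisms out of a C*-algebra these are automatically
  -- contractive, so no continuity of `e` has to be known.
  let ρ : Ω → A →⋆ₙₐ[ℂ] Matrix (Fin n) (Fin n) ℂ := fun ω =>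
    { toFun := fun a => (e a : Matrix (Fin n) (Fin n) C(Ω, ℂ)).map fun f => f ω
      map_smul' := fun z a => by ext i j; simp
      map_zero' := by ext i j; simp
      map_add' := fun a b => by ext i j; simp
      map_mul' := fun a b => by ext i j; simp [Matrix.mul_apply]
      map_star' := fun a => by
        have h : (e (star a) : Matrix (Fin n) (Fin n) C(Ω, ℂ)) = star (e a).1 :=
          congrArg Subtype.val (e.map_star' a)
        ext i j
        change (e (star a)).1 i j ω = star ((e a).1 j i ω)
        rw [h]
        rfl }
  let c : A.toSubmodule ≃ₗ[ℂ] A :=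
    { toFun := fun v => ⟨v.1, v.2⟩
      invFun := fun v => ⟨v.1, v.2⟩
      map_add' := fun _ _ => rfl
      map_smul' := fun _ _ => rfl
      left_inv := fun _ => rfl
      right_inv := fun _ => rfl }
  refine ⟨S, hS, SchurMult.isCompletelyCompact_of_isCompactOperator (π := π)
    Subtype.val_injective ρ (fun a => ?_) (fun a ha => ?_) c (fun _ => rfl)
    (continuous_subtype_val.subtype_mk _) hS.2.1 hS.2.2 hSc⟩
  · exact continuous_matrix fun i j => ContinuousMap.continuous ((e a).1 i j)
  · have h1 : e a = 0 := by
      refine Subtype.ext ?_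
      ext i j ω
      exact congrFun (congrFun (ha ω) i) j
    exact (map_eq_zero_iff e e.injective).1 h1
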